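/- Fix integers $N, n \ge 0$. Let $\mathcal U=\mathbb Z\langle u_1,\dots,u_N\rangle$ be the free associative algebra, whose monomials are identified with the words in the alphabet $\{1,\dots,N\}$, and let $\langle\cdot,\cdot\rangle$ be the symmetric bilinear form on $\mathcal U$ for which the monomials form an orthonormal basis. Put $e_d(\mathbf u)=\sum_{N\ge i_1>\cdots>i_d\ge1}u_{i_1}\cdots u_{i_d}$ for $d>0$, $e_0(\mathbf u)=1$, $e_d(\mathbf u)=0$ for $d<0$, and for a partition $\lambda$ with conjugate $\lambda'=(\lambda'_1,\dots,\lambda'_t)$ (where $t=\lambda_1$) put $$\mathfrak J_\lambda(\mathbf u)=\sum_{\pi\in S_t}\operatorname{sgn}(\pi)\,e_{\lambda'_1+\pi(1)-1}(\mathbf u)\,e_{\lambda'_2+\pi(2)-2}(\mathbf u)\cdots e_{\lambda'_t+\pi(t)-t}(\mathbf u).$$ Let $\mathcal W_n$ be the set of words of length $n$ in $\{1,\dots,N\}$ with no repeated letter. For letters $a<b<c$ and words $v,w$ such that the word $v\,abc\,w$ has no repeated letter, the KR$_i$ square given by $v,w,a,b,c$, where $i=|v|+2$, is the set $X=\{v\,bac\,w,\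 v\,bca\,w,\ v\,acb\,w,\ v\,cab\,w\}$. A partial D$_0$ graph of degree $n$ is a graph $H$ on a vertex set $W=V(H)\subseteq\mathcal W_n$, with edges colored from $\{2,\dots,n-1\}$ (two vertices may be joined by edges of several colors), such that for each KR$_i$ square $X$ exactly one of the following occurs: (i) $X\cap W=\varnothing$; (ii) $X\cap W$ is $\{v\,bac\,w,v\,bca\,w\}$ or $\{v\,acb\,w,v\,cab\,w\}$ and is an $i$-edge; (iii) $X\cap W$ is $\{v\,bac\,w,v\,acb\,w\}$ or $\{v\,bca\,w,v\,cab\,w\}$ and is an $i$-edge; (iv) $X\subseteq W$ and both pairs in (ii) are $i$-edges; (v) $X\subseteq W$ and both pairs in (iii) are $i$-edges; (vi) $X\subseteq W$ and no $i$-edge has both ends in $X$. It is a D$_0$ graph if (vi) never occurs. For a word $w=w_1\cdots w_n$ let $\mathrm{Des}(w)=\{i\in\{1,\dots,n-1\}: w_i>w_{i+1}\}$ and let $$Q_{\mathrm{Des}(w)}(\mathbf x)=\sum_{\substack{1\le i_1\le\cdots\le i_n\\ j\in\mathrm{Des}(w)\Rightarrow i_j<i_{j+1}}}x_{i_1}\cdots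 x_{i_n}$$ be Gessel's fundamental quasisymmetric function in the variables $x_1,x_2,\dots$. The generating function of $H$ is $\sum_{w\in V(H)}Q_{\mathrm{Des}(w)}(\mathbf x)$. **Corollary.** The generating function of any partial D$_0$ graph $H$ (in particular, of any D$_0$ graph) is a symmetric function. Hence it is in a unique way a finite integer linear combination of Schur functions $s_\lambda(\mathbf x)$, and for every partition $\lambda$ the coefficient of $s_\lambda(\mathbf x)$ in it equals $$\Big\langle \mathfrak J_\lambda(\mathbf u),\ \sum_{w\in V(H)}w\Big\rangle .$$ -/

import Mathlib

noncomputable section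

/-! ### The free associative algebra and noncommutative Schur functions -/

/-- Words in the alphabet `{1, 2, …, N}`, modelled as lists over `Fin N` (only the order of the
letters matters). -/
abbrev KRWord (N : ℕ) : Type := List (Fin N)

/-- The free associative algebra `ℤ⟨u_1, …, u_N⟩`, realized as the monoid algebra of the free
monoid, so that the words form a `ℤ`-basis and the product concatenates words. -/
abbrev FreeAlg (N : ℕ) : Type := MonoidAlgebra ℤ (FreeMonoid (Fin N))

/-- The monomial of the free associative algebra given by a word. -/
def wordMonomial {N : ℕ} (w : KRWord N) : FreeAlg N :=
  MonoidAlgebra.single (FreeMonoid.ofList w) 1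

/-- The symmetric bilinear form on the free associative algebra for which the monomials form an
orthonormal basis: `⟨f, g⟩ = ∑_w f_w g_w`. -/
def wordPairing {N : ℕ} (f g : FreeAlg N) : ℤ :=
  f.coeff.sum fun w a => a * g.coeff w

open Classical in
/-- The noncommutative elementary symmetric function
`e_d(u) = ∑_{N ≥ i_1 > ⋯ > i_d ≥ 1} u_{i_1} ⋯ u_{i_d}`, with `e_d(u) = 0` for `d < 0`.
For `d = 0` the only summand is the empty word, so `e_0(u) = 1`. -/
def ncElementary (N : ℕ) (d : ℤ) : FreeAlg N :=
  if 0 ≤ d then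
    ∑ i : Fin d.toNat → Fin N with StrictAnti i, wordMonomial (List.ofFn i)
  else 0

/-- The noncommutative Schur function
`𝔍_μ(u) = ∑_{π ∈ S_t} sgn(π) e_{μ'_1 + π(1) - 1}(u) ⋯ e_{μ'_t + π(t) - t}(u)`, where
`μ' = (μ'_1, …, μ'_t)` is the conjugate partition of `μ`, that is, the list of the column lengths
of `μ`, and `t` is the length of the first row. The indices below start at `0`, which leaves the
differences `π(j) - j` unchanged. The factors are multiplied in increasing order of `j`. -/
def ncSchur (N : ℕ) (μ : YoungDiagram) : FreeAlg N :=
  ∑ π : Equiv.Perm (Fin (μ.rowLen 0)),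
    (Equiv.Perm.sign π : ℤ) •
      (List.ofFn fun j : Fin (μ.rowLen 0) =>
        ncElementary N ((μ.colLen j : ℤ) + ((π j : ℕ) : ℤ) - ((j : ℕ) : ℤ))).prod

/-! ### Symmetric and quasisymmetric functions in the variables `x_0, x_1, x_2, …` -/

/-- `F` is a symmetric function in countably many variables: a formal power series of bounded
degree which is invariant under all permutations of the variables. -/
def IsSymmetricFunction (F : MvPowerSeries ℕ ℤ) : Prop :=
  (∃ d : ℕ, ∀ m : ℕ →₀ ℕ, MvPowerSeries.coeff m F ≠ 0 → m.degree ≤ d) ∧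
    ∀ σ : Equiv.Perm ℕ, MvPowerSeries.rename σ F = F

/-- The Schur function `s_μ(x) = ∑_T x^T`, the sum over all semistandard Young tableaux `T` of
shape `μ`: the coefficient of `x^m` is the number of those with content `m`. -/
def schurFunction (μ : YoungDiagram) : MvPowerSeries ℕ ℤ := fun m =>
  ({T : SemistandardYoungTableau μ |
    ∑ c ∈ μ.cells, Finsupp.single (T c.1 c.2) 1 = m}.ncard : ℤ)

/-- The descent set `{i ∈ [n-1] | w_i > w_{i+1}}` of the word `w = w_1 ⋯ w_n`. The entry `w_i` is
`w[i - 1]`, as lists are indexed from `0`. -/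
def descentSet {N : ℕ} (w : KRWord N) : Set ℕ :=
  {i | 1 ≤ i ∧ ∃ h : i < w.length, w[i] < w[i - 1]}

/-- Gessel's fundamental quasisymmetric function of degree `n`, for a set `D ⊆ [n-1]`:
the sum of `x_{i_1} ⋯ x_{i_n}` over all `i_1 ≤ ⋯ ≤ i_n` such that `i_j < i_{j+1}` for `j ∈ D`;
the coefficient of `x^m` is the number of such sequences with monomial `x^m`. The sequences are
indexed from `0`, so that the positions `j`, `j + 1` below are the `(j+1)`-st and the `(j+2)`-nd. -/
def fundamentalQuasisymmetric (n : ℕ) (D : Set ℕ) : MvPowerSeries ℕ ℤ := fun m =>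
  ({i : Fin n → ℕ | Monotone i ∧
      (∀ (j : ℕ) (h : j + 1 < n), j + 1 ∈ D → i ⟨j, Nat.lt_of_succ_lt h⟩ < i ⟨j + 1, h⟩) ∧
      ∑ j, Finsupp.single (i j) 1 = m}.ncard : ℤ)

/-! ### Partial D₀ graphs -/

/-- The words `v bac w`, `v bca w`, `v acb w`, `v cab w` are obtained from this one by taking for
`x y z` the respective three letters. -/
def insertTriple {N : ℕ} (v w : KRWord N) (x y z : Fin N) : KRWord N :=
  v ++ [x, y, z] ++ w

/-- The set of the four words of a KR square `(v bac w, v bca w, v acb w, v cab w)`. -/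
def krSquare {N : ℕ} (v w : KRWord N) (a b c : Fin N) : Set (KRWord N) :=
  {insertTriple v w b a c, insertTriple v w b c a,
    insertTriple v w a c b, insertTriple v w c a b}

/-- The six possibilities for a KR square `X` relative to a graph with vertex set `W`. -/
inductive KRPossibility : Type
  | disjoint
  | knuthPair
  | rotationPair
  | knuthFull
  | rotationFull
  | undetermined

/-- When a possibility occurs for the KR square `X` given by `v`, `w` and `a < b < c`, in a graph
with vertex set `W`; here `E` is the graph formed by the `i`-edges, where `i = |v| + 2`. -/
def KRPossibility.Occurs {N : ℕ} (W : Set (KRWord N)) (E : SimpleGraph (KRWord N))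
    (v w : KRWord N) (a b c : Fin N) : KRPossibility → Prop
  | .disjoint => krSquare v w a b c ∩ W = ∅
  | .knuthPair =>
      (krSquare v w a b c ∩ W = {insertTriple v w b a c, insertTriple v w b c a} ∧
        E.Adj (insertTriple v w b a c) (insertTriple v w b c a)) ∨
      (krSquare v w a b c ∩ W = {insertTriple v w a c b, insertTriple v w c a b} ∧
        E.Adj (insertTriple v w a c b) (insertTriple v w c a b))
  | .rotationPair =>
      (krSquare v w a b c ∩ W = {insertTriple v w b a c, insertTriple v w a c b} ∧
        E.Adj (insertTriple v w b a c) (insertTriple v w a c b)) ∨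
      (krSquare v w a b c ∩ W = {insertTriple v w b c a, insertTriple v w c a b} ∧
        E.Adj (insertTriple v w b c a) (insertTriple v w c a b))
  | .knuthFull =>
      krSquare v w a b c ⊆ W ∧
        E.Adj (insertTriple v w b a c) (insertTriple v w b c a) ∧
        E.Adj (insertTriple v w a c b) (insertTriple v w c a b)
  | .rotationFull =>
      krSquare v w a b c ⊆ W ∧
        E.Adj (insertTriple v w b a c) (insertTriple v w a c b) ∧
        E.Adj (insertTriple v w b c a) (insertTriple v w c a b)
  | .undetermined =>
      krSquare v w a b c ⊆ W ∧
        ∀ x ∈ krSquare v w a b c, ∀ y ∈ krSquare v w a b c, ¬ E.Adj x y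

/-- A partial D₀ graph of degree `n` in the alphabet `{1, …, N}`. Two vertices may be joined by
several edges of different colors, so the edges are given color by color. -/
structure PartialD0Graph (N n : ℕ) where
  /-- The vertex set. -/
  verts : Finset (KRWord N)
  /-- The vertices are words of length `n`. -/
  length_eq : ∀ w ∈ verts, w.length = n
  /-- The vertices are words with no repeated letter. -/
  nodup : ∀ w ∈ verts, w.Nodup
  /-- The graph formed by the `i`-edges. -/
  edges : ℕ → SimpleGraph (KRWord N)
  /-- Edges join vertices. -/
  mem_of_adj : ∀ i x y, (edges i).Adj x y → x ∈ verts ∧ y ∈ verts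
  /-- The colors of the edges are among `2, 3, …, n - 1`. -/
  color_mem : ∀ i x y, (edges i).Adj x y → 2 ≤ i ∧ i + 1 ≤ n
  /-- For each KR square, exactly one of the six possibilities occurs. -/
  existsUnique_possibility : ∀ (v w : KRWord N) (a b c : Fin N), a < b → b < c →
    (insertTriple v w a b c).Nodup →
      ∃! p : KRPossibility, p.Occurs (verts : Set (KRWord N)) (edges (v.length + 2)) v w a b c

/-- A partial D₀ graph is a D₀ graph if no KR square is undetermined. -/
def PartialD0Graph.IsD0Graph {N n : ℕ} (H : PartialD0Graph N n) : Prop :=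
  ∀ (v w : KRWord N) (a b c : Fin N), a < b → b < c → (insertTriple v w a b c).Nodup →
    ¬ KRPossibility.undetermined.Occurs (H.verts : Set (KRWord N)) (H.edges (v.length + 2))
      v w a b c

/-- The sum of the vertices of `H` in the free associative algebra. -/
def PartialD0Graph.vertexSum {N n : ℕ} (H : PartialD0Graph N n) : FreeAlg N :=
  ∑ w ∈ H.verts, wordMonomial w

/-- The generating function `∑_{w ∈ V(H)} Q_{Des(w)}(x)` of `H`. -/
def PartialD0Graph.generatingFunction {N n : ℕ} (H : PartialD0Graph N n) : MvPowerSeries ℕ ℤ :=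
  ∑ w ∈ H.verts, fundamentalQuasisymmetric n (descentSet w)

end

/-! Let `functional` be the additive map on $\mathcal U$ sending a word to 1 if it is a vertex of
$H$ and to 0 otherwise, so that pairing with $\sum_{w\in V(H)}w$ is applying it. Each of the six
possibilities for a KR square puts as many vertices in $\{bac, cab\}$ as in $\{bca, acb\}$
(`functional_krSquare`), and no vertex repeats a letter. Hence the functional vanishes on a
two-sided ideal, `kernelIdeal`, modulo which $u_b$ commutes with $u_au_c-u_cu_a$ for $a<b<c$ and
$u_a x u_a=0$ for all $x$.

In such a quotient the $e_k(\mathbf u)$ commute (`commute_listElementary`). Let $h_k(\mathbf u)$ be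
the sum of the strictly increasing words of length $k$. The series $\sum(-1)^kh_kX^k$ is inverse to
$\sum e_kX^k$ (`sum_listComplete_mul_listElementary`), so the $h_k$ lie in the commutative subring
generated by the $e_k$, where $\mathfrak J_\mu$ becomes the dual Jacobi–Trudi determinant.

For a word $w$ without repeated letters, the coefficient of $x^m$ in $Q_{\mathrm{Des}(w)}$ is the
coefficient of $w$ in $h_{m_0}h_{m_1}\cdots$ (`coeff_fundamentalQuasisymmetric`). So the coefficient
of $x^m$ in the generating function is the functional applied to $\prod_i h_{m_i}$. Commutativity
gives symmetry. The expansion $\prod_i h_{m_i}=\sum_\mu K_{\mu m}\mathfrak J_\mu$ in the commutative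
subring, obtained by iterating the Pieri rule (`prod_complete_eq_sum_kostka`), gives the Schur
coefficients. Uniqueness is the triangularity of the Kostka numbers
(`linearIndependent_schurFunction`). -/

noncomputable section

/-! ### Noncommutative elementary and complete homogeneous symmetric functions -/

section NoncommutativeSymmetric

variable {A α : Type*} [Ring A]

/-- The sum of the products `u a₁ * ⋯ * u a_k` over the sublists `[a₁, …, a_k]` of a list. -/
def listElementary (u : α → A) : List α → ℕ → A
  | _, 0 => 1
  | [], _ + 1 => 0
  | a :: l, k + 1 => listElementary u l (k + 1) + u a * listElementary u l k

/-- The sum of the products `u a_k * ⋯ * u a₁` over the sublists `[a₁, …, a_k]` of a list. -/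
def listComplete (u : α → A) : List α → ℕ → A
  | _, 0 => 1
  | [], _ + 1 => 0
  | a :: l, k + 1 => listComplete u l (k + 1) + listComplete u l k * u a

@[simp] theorem listElementary_zero (u : α → A) (l : List α) : listElementary u l 0 = 1 := by
  cases l <;> rfl

@[simp] theorem listComplete_zero (u : α → A) (l : List α) : listComplete u l 0 = 1 := by
  cases l <;> rfl

@[simp] theorem listElementary_nil_succ (u : α → A) (k : ℕ) :
    listElementary u [] (k + 1) = 0 := rfl

@[simp] theorem listComplete_nil_succ (u : α → A) (k : ℕ) : listComplete u [] (k + 1) = 0 := rfl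

theorem listElementary_cons_succ (u : α → A) (a : α) (l : List α) (k : ℕ) :
    listElementary u (a :: l) (k + 1) = listElementary u l (k + 1) + u a * listElementary u l k :=
  rfl

theorem listComplete_cons_succ (u : α → A) (a : α) (l : List α) (k : ℕ) :
    listComplete u (a :: l) (k + 1) = listComplete u l (k + 1) + listComplete u l k * u a :=
  rfl

theorem map_listElementary {B : Type*} [Ring B] (f : A →+* B) (u : α → A) (l : List α) (k : ℕ) :
    f (listElementary u l k) = listElementary (fun a => f (u a)) l k := by
  induction l generalizing k with
  | nil => cases k <;> simp
  | cons a l ih => cases k <;> simp [listElementary_cons_succ, ih]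

theorem map_listComplete {B : Type*} [Ring B] (f : A →+* B) (u : α → A) (l : List α) (k : ℕ) :
    f (listComplete u l k) = listComplete (fun a => f (u a)) l k := by
  induction l generalizing k with
  | nil => cases k <;> simp
  | cons a l ih => cases k <;> simp [listComplete_cons_succ, ih]

open Finset in
/-- The generating series of the complete functions is inverse to that of the elementary ones. -/
theorem sum_listComplete_mul_listElementary (u : α → A) (hrep : ∀ a x, u a * x * u a = 0)
    (l : List α) (k : ℕ) :
    ∑ p ∈ antidiagonal (k + 1), (-1 : A) ^ p.1 * (listComplete u l p.1 * listElementary u l p.2)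
      = 0 := by
  have key : (PowerSeries.mk fun i => (-1 : A) ^ i * listComplete u l i) *
      (PowerSeries.mk fun i => listElementary u l i) = 1 := by
    induction l with
    | nil =>
      have h1 : (PowerSeries.mk fun i => (-1 : A) ^ i * listComplete u [] i) = 1 := by
        ext i; cases i <;> simp [PowerSeries.coeff_one]
      have h2 : (PowerSeries.mk fun i => listElementary u [] i) = 1 := by
        ext i; cases i <;> simp [PowerSeries.coeff_one]
      rw [h1, h2, mul_one]
    | cons a l ih =>
      have h1 : (PowerSeries.mk fun i => (-1 : A) ^ i * listComplete u (a :: l) i) =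
          (PowerSeries.mk fun i => (-1 : A) ^ i * listComplete u l i) *
            (1 - PowerSeries.C (u a) * PowerSeries.X) := by
        ext i
        cases i with
        | zero => simp [mul_sub, ← mul_assoc]
        | succ i =>
          simp [← mul_assoc, PowerSeries.coeff_succ_mul_X, listComplete_cons_succ, pow_succ,
            mul_add, sub_eq_add_neg]
      have h2 : (PowerSeries.mk fun i => listElementary u (a :: l) i) =
          (1 + PowerSeries.C (u a) * PowerSeries.X) *
            (PowerSeries.mk fun i => listElementary u l i) := by
        ext i
        cases i with
        | zero => simp [add_mul, mul_assoc]
        | succ i =>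
          simp [add_mul, mul_assoc, PowerSeries.coeff_succ_X_mul, listElementary_cons_succ]
      -- Since $u_a^2=0$, the innermost factors $1-u_aX$ and $1+u_aX$ cancel. This is why strictly
      -- increasing words suffice for $h_k$.
      have h3 : (1 - PowerSeries.C (u a) * PowerSeries.X) *
          (1 + PowerSeries.C (u a) * PowerSeries.X) = (1 : PowerSeries A) := by
        have h4 : PowerSeries.C (u a) * PowerSeries.X * (PowerSeries.C (u a) * PowerSeries.X)
            = (0 : PowerSeries A) := by
          have := hrep a 1
          rw [mul_one] at this
          rw [mul_assoc, ← mul_assoc PowerSeries.X, (PowerSeries.commute_X _).symm.eq, mul_assoc,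
            ← mul_assoc, ← map_mul, this, map_zero, zero_mul]
        rw [sub_mul, mul_add, mul_add, h4]
        simp
      rw [h1, h2, mul_assoc, ← mul_assoc (1 - _), h3, one_mul, ih]
  have := congrArg (PowerSeries.coeff (k + 1)) key
  simpa [PowerSeries.coeff_mul, PowerSeries.coeff_one, mul_assoc] using this

/-- Left multiplication by $x$ kills every product in which $u_b$ occurs, so the letter $b$ may be
dropped from the list. -/
theorem mul_listElementary_erase [DecidableEq α] (u : α → A) (b : α) (l : List α) (k : ℕ) (x : A)
    (hx : ∀ y, x * y * u b = 0) :
    x * listElementary u (l.erase b) k = x * listElementary u l k := by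
  induction l generalizing k x with
  | nil => rfl
  | cons a l ih =>
    cases k with
    | zero => simp
    | succ k =>
      by_cases hab : a = b
      · subst hab
        have h := hx 1
        rw [mul_one] at h
        rw [List.erase_cons_head, listElementary_cons_succ, mul_add, ← mul_assoc, h, zero_mul,
          add_zero]
      · rw [List.erase_cons_tail (by simpa using hab), listElementary_cons_succ,
          listElementary_cons_succ, mul_add, mul_add, ih _ _ hx, ← mul_assoc, ← mul_assoc,
          ih _ (x * u a) fun y => by rw [mul_assoc x, hx]]

variable [LinearOrder α]

/-- By the Leibniz rule the commutator is a sum of products with one letter $u_b$ replaced by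
$[u_b,u_c]$. The letters $a$ to its left satisfy $b<a<c$, so `hrel` moves them past $[u_b,u_c]$,
which comes to the front. -/
theorem commutator_listElementary (u : α → A)
    (hrel : ∀ a b c, a < b → b < c → Commute (u b) (u a * u c - u c * u a))
    (c : α) (l : List α) (hl : (c :: l).Pairwise (· > ·)) (k : ℕ) :
    listElementary u l (k + 1) * u c - u c * listElementary u l (k + 1) =
      (l.map fun b => (u b * u c - u c * u b) * listElementary u (l.erase b) k).sum := by
  induction l generalizing k with
  | nil => simp
  | cons a l ih =>
    have hl' : (c :: l).Pairwise (· > ·) := hl.sublist (by simp)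
    have hca : a < c := (List.pairwise_cons.1 hl).1 a (by simp)
    have hla : ∀ b ∈ l, b < a := (List.pairwise_cons.1 (List.pairwise_cons.1 hl).2).1
    have hmap : (l.map fun b => (u b * u c - u c * u b) * listElementary u ((a :: l).erase b) k)
        = l.map fun b => (u b * u c - u c * u b) * listElementary u (a :: l.erase b) k := by
      refine List.map_congr_left fun b hb => ?_
      rw [List.erase_cons_tail (by simpa using (hla b hb).ne')]
    rw [List.map_cons, List.sum_cons, List.erase_cons_head, hmap, listElementary_cons_succ]
    have e1 : (listElementary u l (k + 1) + u a * listElementary u l k) * u c -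
        u c * (listElementary u l (k + 1) + u a * listElementary u l k) =
        (u a * u c - u c * u a) * listElementary u l k +
        ((listElementary u l (k + 1) * u c - u c * listElementary u l (k + 1)) +
          u a * (listElementary u l k * u c - u c * listElementary u l k)) := by
      noncomm_ring
    rw [e1, ih hl']
    congr 1
    cases k with
    | zero => simp
    | succ k =>
      rw [ih hl', ← List.sum_map_mul_left, ← List.sum_map_add]
      congr 1
      refine List.map_congr_left fun b hb => ?_
      rw [listElementary_cons_succ, mul_add, ← mul_assoc, ← mul_assoc,
        (hrel b a c (hla b hb) hca).eq]

/-- The noncommutative elementary symmetric functions commute. -/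
theorem commute_listElementary (u : α → A) (hrep : ∀ a x, u a * x * u a = 0)
    (hrel : ∀ a b c, a < b → b < c → Commute (u b) (u a * u c - u c * u a))
    (l : List α) (hl : l.Pairwise (· > ·)) (j k : ℕ) :
    Commute (listElementary u l j) (listElementary u l k) := by
  induction hn : l.length using Nat.strong_induction_on generalizing l j k with
  | _ n ih =>
    cases l with
    | nil => cases j <;> cases k <;> simp
    | cons c l =>
      cases j with
      | zero => simp
      | succ j =>
        cases k with
        | zero => simp
        | succ k =>
          have hl' := (List.pairwise_cons.1 hl).2
          have ih0 : ∀ j k, Commute (listElementary u l j) (listElementary u l k) := fun j k =>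
            ih l.length (by simp at hn; omega) l hl' j k rfl
          have hd : ∀ b y, (u b * u c - u c * u b) * y * u b = 0 := fun b y => by
            have h1 := hrep b (u c * y)
            have h2 := hrep b y
            rw [sub_mul, sub_mul, mul_assoc (u b), h1, mul_assoc (u c), mul_assoc (u c), h2]
            simp
          -- Both sides become sums over $b$ of $[u_b,u_c]$ times a product of two elementary
          -- functions. Since $[u_b,u_c]\,y\,u_b=0$, both functions may be taken over the list
          -- without $b$, where they commute by induction.
          have hkey : (listElementary u l (j + 1) * u c - u c * listElementary u l (j + 1)) *
              listElementary u l k =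
              (listElementary u l (k + 1) * u c - u c * listElementary u l (k + 1)) *
              listElementary u l j := by
            rw [commutator_listElementary u hrel c l hl, commutator_listElementary u hrel c l hl,
              ← List.sum_map_mul_right, ← List.sum_map_mul_right]
            congr 1
            refine List.map_congr_left fun b hb => ?_
            have hd' : ∀ i y, (u b * u c - u c * u b) * listElementary u (l.erase b) i * y * u b
              = 0 := fun i y => by rw [mul_assoc _ _ y, hd]
            rw [← mul_listElementary_erase u b l k _ (hd' j),
              ← mul_listElementary_erase u b l j _ (hd' k), mul_assoc, mul_assoc]
            congr 1
            refine ih (l.erase b).length ?_ _ (hl'.sublist List.erase_sublist) _ _ rfl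
            have := (List.erase_sublist (a := b) (l := l)).length_le
            simp at hn
            omega
          have h1 := (ih0 (j + 1) (k + 1)).eq
          have h2 := (ih0 j k).eq
          have h3 := (ih0 j (k + 1)).eq
          have h4 := (ih0 k (j + 1)).eq
          rw [commute_iff_eq, listElementary_cons_succ, listElementary_cons_succ]
          generalize listElementary u l (j + 1) = J at *
          generalize listElementary u l (k + 1) = K at *
          generalize listElementary u l j = j' at *
          generalize listElementary u l k = k' at *
          -- The commutator splits into commutators over the shorter list, the difference that
          -- `hkey` makes zero, and terms containing $u_c$ twice.
          have e1 : (J + u c * j') * (K + u c * k') - (K + u c * k') * (J + u c * j') =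
            (J * K - K * J) + ((J * u c - u c * J) * k' - (K * u c - u c * K) * j')
            + u c * (j' * K - K * j') - u c * (k' * J - J * k')
            + (u c * j' * u c * k' - u c * k' * u c * j') := by noncomm_ring
          rw [← sub_eq_zero, e1, hkey, h1, h3, h4, hrep, hrep]
          simp

end NoncommutativeSymmetric

/-! ### Jacobi–Trudi determinants and the Pieri rule -/

/-- Extension of a sequence to the integers by zero. -/
def extendByZero {C : Type*} [Zero C] (e : ℕ → C) (d : ℤ) : C := if 0 ≤ d then e d.toNat else 0

theorem extendByZero_natCast {C : Type*} [Zero C] (e : ℕ → C) (d : ℕ) : extendByZero e d = e d := by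
  simp [extendByZero]

theorem extendByZero_of_neg {C : Type*} [Zero C] (e : ℕ → C) {d : ℤ} (hd : d < 0) : extendByZero e d = 0 := by
  simp [extendByZero, hd]

section JacobiTrudi

variable {C : Type*} [CommRing C]

/-- The matrix `(e_{c_i + j - i})` of size `T`. -/
def jacobiTrudiMatrix (e : ℕ → C) (T : ℕ) (c : ℕ → ℕ) : Matrix (Fin T) (Fin T) C :=
  Matrix.of fun i j => extendByZero e ((c i : ℤ) + (j : ℕ) - (i : ℕ))

/-- The determinant of the matrix `(e_{c_i + j - i})` of size `T`. -/
def jacobiTrudi (e : ℕ → C) (T : ℕ) (c : ℕ → ℕ) : C := (jacobiTrudiMatrix e T c).det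

/-- The last row has entries $e_{j-T}$, so it is $(0,\dots,0,1)$. -/
theorem jacobiTrudi_succ (e : ℕ → C) (he : e 0 = 1) (T : ℕ) (c : ℕ → ℕ) (hc : c T = 0) :
    jacobiTrudi e (T + 1) c = jacobiTrudi e T c := by
  have hlast : ∀ j : Fin (T + 1), jacobiTrudiMatrix e (T + 1) c (Fin.last T) j =
      if j = Fin.last T then 1 else 0 := by
    intro j
    split_ifs with h
    · subst h
      simp [jacobiTrudiMatrix, hc, extendByZero, he]
    · have : (j : ℕ) < T := by
        have := j.2
        have h' : (j : ℕ) ≠ T := fun h' => h (Fin.ext h')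
        omega
      simp only [jacobiTrudiMatrix, Matrix.of_apply, Fin.val_last, hc]
      exact extendByZero_of_neg e (by push_cast; omega)
  rw [jacobiTrudi, Matrix.det_succ_row _ (Fin.last T), Finset.sum_eq_single (Fin.last T)]
  · simp only [hlast, if_true, mul_one, jacobiTrudi, ← two_mul, pow_mul]
    simp only [even_two, Even.neg_pow, one_pow, one_mul]
    congr 1
    ext i j
    simp [jacobiTrudiMatrix, Fin.succAbove_last]
  · intro j _ hj
    simp [hlast, hj]
  · simp

theorem jacobiTrudi_of_le (e : ℕ → C) (he : e 0 = 1) {t T : ℕ} (htT : t ≤ T) (c : ℕ → ℕ)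
    (hc : ∀ i, t ≤ i → c i = 0) : jacobiTrudi e T c = jacobiTrudi e t c := by
  induction T, htT using Nat.le_induction with
  | base => rfl
  | succ T hT ih => rw [jacobiTrudi_succ e he T c (hc T hT), ih]

/-- Rows $i$ and $i+1$ coincide. This disposes of the terms of the Pieri rule whose column lengths
do not form a partition. -/
theorem jacobiTrudi_eq_zero (e : ℕ → C) (T : ℕ) (c : ℕ → ℕ) (i : ℕ) (hi : i + 1 < T)
    (hc : c (i + 1) = c i + 1) : jacobiTrudi e T c = 0 := by
  refine Matrix.det_zero_of_row_eq (i := ⟨i, by omega⟩) (j := ⟨i + 1, hi⟩) (by simp) ?_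
  ext j
  simp only [jacobiTrudiMatrix, Matrix.of_apply, hc]
  congr 1
  push_cast
  ring

open Finset in
-- In the Leibniz expansion, replacing $S$ by its preimage under the permutation turns a choice of
-- $k$ rows to shift into a choice of $k$ columns. A shifted column followed by an unshifted one
-- gives two equal columns, so only the choice of the last $k$ columns survives; it skips column
-- $T-k$ of $M$.
theorem sum_det_shift {T : ℕ} (M : Matrix (Fin T) (Fin (T + 1)) C) (k : ℕ) (hk : k ≤ T) :
    ∑ S ∈ powersetCard k (univ : Finset (Fin T)),
        (Matrix.of fun i j : Fin T => M i (if i ∈ S then j.succ else j.castSucc)).det =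
      (M.submatrix id (Fin.succAbove ⟨T - k, by omega⟩)).det := by
  have hswap : ∑ S ∈ powersetCard k (univ : Finset (Fin T)),
        (Matrix.of fun i j : Fin T => M i (if i ∈ S then j.succ else j.castSucc)).det =
      ∑ S ∈ powersetCard k (univ : Finset (Fin T)),
        (Matrix.of fun i j : Fin T => M i (if j ∈ S then j.succ else j.castSucc)).det := by
    simp only [Matrix.det_apply, Matrix.of_apply]
    rw [sum_comm, sum_comm (s := powersetCard k univ)]
    refine sum_congr rfl fun σ _ => ?_
    refine sum_nbij' (fun S => S.map σ.symm.toEmbedding) (fun S => S.map σ.toEmbedding) ?_ ?_ ?_ ?_ ?_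
    · simp [mem_powersetCard]
    · simp [mem_powersetCard]
    · intro S _
      ext x
      simp
    · intro S _
      ext x
      simp
    · intro S _
      simp
  rw [hswap]
  set S₀ : Finset (Fin T) := univ.filter fun j => T - k ≤ (j : ℕ) with hS₀
  have hcard : #S₀ = k := by
    have : S₀.map Fin.valEmbedding = Ico (T - k) T := by
      ext x
      simp only [hS₀, mem_map, mem_filter, mem_univ, true_and, Fin.valEmbedding_apply, mem_Ico]
      constructor
      · rintro ⟨a, ha, rfl⟩
        exact ⟨ha, a.2⟩
      · rintro ⟨h1, h2⟩
        exact ⟨⟨x, h2⟩, h1, rfl⟩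
    rw [← card_map Fin.valEmbedding, this, Nat.card_Ico]
    omega
  rw [sum_eq_single S₀]
  · congr 1
    ext i j
    simp only [Matrix.of_apply, Matrix.submatrix_apply, id, Fin.succAbove, hS₀, mem_filter,
      mem_univ, true_and, Fin.lt_def, Fin.val_castSucc]
    by_cases h : T - k ≤ (j : ℕ)
    · rw [if_pos h, if_neg (by omega)]
    · rw [if_neg h, if_pos (by omega)]
  · intro S hS hne
    have hSk := (mem_powersetCard.1 hS).2
    -- Otherwise $S$ would be closed upwards, hence equal to the set of the last $k$ indices.
    have hex : ∃ (j : ℕ) (hj : j + 1 < T), (⟨j, by omega⟩ : Fin T) ∈ S ∧ (⟨j + 1, hj⟩ : Fin T) ∉ S := by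
      by_contra! hcon
      refine hne (eq_of_subset_of_card_le (fun j hj => ?_) (by rw [hSk, hcard]))
      have hup : ∀ (j' : ℕ), (j : ℕ) ≤ j' → ∀ h : j' < T, (⟨j', h⟩ : Fin T) ∈ S := by
        intro j' hj'
        induction j', hj' using Nat.le_induction with
        | base => intro _; exact hj
        | succ j' _ ih => intro h; exact hcon j' h (ih (by omega))
      have hsub : Ici j ⊆ S := fun j' hj' => hup j' (by simpa using hj') j'.2
      have := card_le_card hsub
      rw [Fin.card_Ici, hSk] at this
      simp only [hS₀, mem_filter, mem_univ, true_and]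
      omega
    obtain ⟨j, hj, h1, h2⟩ := hex
    refine Matrix.det_zero_of_column_eq (i := ⟨j, by omega⟩) (j := ⟨j + 1, hj⟩) (by simp) fun i => ?_
    simp [h1, h2]
  · intro h
    exact absurd (mem_powersetCard.2 ⟨subset_univ _, hcard⟩) h

open Finset in
-- The rows $q\ge p=T-k$ have $c_q=0$, so they are $(e_{j-q})_j$, and by `hrel` the combination with
-- coefficients $(-1)^{q-p}h_{q-p}$ is the unit vector at $p$. Putting this combination in place of
-- the last row multiplies the determinant by $(-1)^kh_k$; expanding along the new row gives the
-- minor with the same sign.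
theorem complete_mul_jacobiTrudi_eq_minor (e h : ℕ → C) (he : e 0 = 1) (hh : h 0 = 1)
    (hrel : ∀ k, ∑ p ∈ antidiagonal (k + 1), (-1) ^ p.1 * (h p.1 * e p.2) = 0)
    {t k T : ℕ} (hT : t + k ≤ T) (c : ℕ → ℕ) (hc : ∀ i, t ≤ i → c i = 0) :
    h k * jacobiTrudi e (T + 1) c =
      ((jacobiTrudiMatrix e (T + 1) c).submatrix Fin.castSucc
        (Fin.succAbove ⟨T - k, by omega⟩)).det := by
  set B := jacobiTrudiMatrix e (T + 1) c with hB
  set p : Fin (T + 1) := ⟨T - k, by omega⟩ with hp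
  have hrow : (Pi.single p 1 : Fin (T + 1) → C) =
      ∑ q, (if p ≤ q then (-1) ^ ((q : ℕ) - p) * h (q - p) else 0) • B q := by
    ext j
    have h1 : ∀ q : Fin (T + 1), (if p ≤ q then (-1) ^ ((q : ℕ) - p) * h (q - p) else 0) * B q j =
        if p ≤ q ∧ q ≤ j then (-1) ^ ((q : ℕ) - p) * (h (q - p) * e (j - q)) else 0 := by
      intro q
      by_cases hq : p ≤ q
      · have hcq : c q = 0 := hc q (by rw [Fin.le_def] at hq; simp only [hp] at hq; omega)
        have hBq : B q j = extendByZero e (((j : ℕ) : ℤ) - (q : ℕ)) := by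
          change extendByZero e ((c q : ℤ) + (j : ℕ) - (q : ℕ)) = _
          rw [hcq, Nat.cast_zero, zero_add]
        by_cases hj : q ≤ j
        · have : ((j : ℕ) : ℤ) - (q : ℕ) = ((j - q : ℕ) : ℤ) := by
            rw [Fin.le_def] at hj
            omega
          rw [if_pos hq, if_pos ⟨hq, hj⟩, hBq, this, extendByZero_natCast, mul_assoc]
        · have : ((j : ℕ) : ℤ) - (q : ℕ) < 0 := by
            rw [Fin.le_def] at hj
            omega
          rw [hBq, extendByZero_of_neg e this, mul_zero, if_neg fun h' => hj h'.2]
      · rw [if_neg hq, zero_mul, if_neg fun h' => hq h'.1]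
    simp only [Finset.sum_apply, Pi.smul_apply, smul_eq_mul, h1]
    by_cases hj : p ≤ j
    · have h2 : ∑ q : Fin (T + 1), (if p ≤ q ∧ q ≤ j then
          (-1) ^ ((q : ℕ) - p) * (h (q - p) * e (j - q)) else 0) =
          ∑ r ∈ antidiagonal ((j : ℕ) - p), (-1) ^ r.1 * (h r.1 * e r.2) := by
        rw [← sum_filter]
        refine sum_nbij' (fun q => ((q : ℕ) - p, (j : ℕ) - q))
          (fun r => Fin.ofNat (T + 1) (p + r.1)) ?_ ?_ ?_ ?_ ?_
        · intro q hq
          simp only [mem_filter, mem_univ, true_and, Fin.le_def] at hq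
          simp only [HasAntidiagonal.mem_antidiagonal]
          omega
        · intro r hr
          simp only [HasAntidiagonal.mem_antidiagonal, Fin.le_def] at hr hj
          have := j.2
          simp only [mem_filter, mem_univ, true_and, Fin.le_def, Fin.val_ofNat]
          rw [Nat.mod_eq_of_lt (by omega)]
          omega
        · intro q hq
          simp only [mem_filter, mem_univ, true_and, Fin.le_def] at hq
          ext
          simp only [Fin.val_ofNat]
          rw [Nat.mod_eq_of_lt (by omega)]
          omega
        · intro r hr
          simp only [HasAntidiagonal.mem_antidiagonal, Fin.le_def] at hr hj
          have := j.2
          ext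
          · simp only [Fin.val_ofNat]
            rw [Nat.mod_eq_of_lt (by omega)]
            omega
          · simp only [Fin.val_ofNat]
            rw [Nat.mod_eq_of_lt (by omega)]
            omega
        · intro q _
          rfl
      rw [h2]
      by_cases hjp : j = p
      · subst hjp
        simp [he, hh]
      · obtain ⟨d, hd⟩ : ∃ d, (j : ℕ) - p = d + 1 := by
          refine Nat.exists_eq_succ_of_ne_zero fun h0 => hjp (Fin.ext ?_)
          rw [Fin.le_def] at hj
          omega
        rw [hd, hrel, Pi.single_eq_of_ne hjp]
    · have hjp : j ≠ p := fun h0 => hj h0.ge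
      rw [Pi.single_eq_of_ne hjp, sum_eq_zero]
      intro q _
      rw [if_neg fun hq => hj (hq.1.trans hq.2)]
  have h1 := Matrix.det_updateRow_sum B (Fin.last T)
    (fun q => if p ≤ q then (-1) ^ ((q : ℕ) - p) * h (q - p) else 0)
  rw [← hrow, Matrix.det_succ_row _ (Fin.last T), Finset.sum_eq_single p, if_pos (Fin.le_last p)] at h1
  · have hk : T - (T - k) = k := by omega
    have hsub : (B.updateRow (Fin.last T) (Pi.single p 1)).submatrix (Fin.last T).succAbove p.succAbove
        = B.submatrix Fin.castSucc p.succAbove := by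
      ext i j
      simp [Fin.succAbove_last, Matrix.updateRow_apply, (Fin.castSucc_lt_last i).ne]
    rw [hsub] at h1
    simp only [Matrix.updateRow_self, Pi.single_eq_same, mul_one, Fin.val_last, hp, hk, smul_eq_mul] at h1
    have hsign : (-1 : C) ^ (T + (T - k)) = (-1) ^ k := by
      have : T + (T - k) = k + 2 * (T - k) := by omega
      rw [this, pow_add, pow_mul]
      simp
    rw [hsign, mul_assoc] at h1
    have h2 := congrArg (fun x => (-1 : C) ^ k * x) h1
    simp only [← mul_assoc, ← pow_add, ← two_mul, pow_mul] at h2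
    simpa [jacobiTrudi] using h2.symm
  · intro j _ hj
    simp [Matrix.updateRow_self, hj]
  · simp

open Finset in
/-- The Pieri rule for Jacobi–Trudi determinants. -/
theorem complete_mul_jacobiTrudi (e h : ℕ → C) (he : e 0 = 1) (hh : h 0 = 1)
    (hrel : ∀ k, ∑ p ∈ antidiagonal (k + 1), (-1) ^ p.1 * (h p.1 * e p.2) = 0)
    {t k T : ℕ} (hT : t + k ≤ T) (c : ℕ → ℕ) (hc : ∀ i, t ≤ i → c i = 0) :
    h k * jacobiTrudi e T c =
      ∑ S ∈ powersetCard k (range T), jacobiTrudi e T fun i => c i + if i ∈ S then 1 else 0 := by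
  rw [← jacobiTrudi_succ e he T c (hc T (by omega)),
    complete_mul_jacobiTrudi_eq_minor e h he hh hrel hT c hc]
  have hrange : range T = (univ : Finset (Fin T)).map Fin.valEmbedding := by
    ext x
    simp
  rw [hrange, powersetCard_map, sum_map]
  -- In the first $T$ rows of the matrix of size $T+1$, shifting row $i$ by one column amounts to
  -- replacing $c_i$ by $c_i+1$.
  have := sum_det_shift ((jacobiTrudiMatrix e (T + 1) c).submatrix Fin.castSucc id) k (by omega)
  rw [Matrix.submatrix_submatrix] at this
  simp only [Function.comp_id, Function.id_comp] at this
  rw [← this]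
  refine sum_congr rfl fun S _ => ?_
  rw [jacobiTrudi]
  congr 1
  ext i j
  have hmem : ((i : ℕ) ∈ S.map Fin.valEmbedding) ↔ i ∈ S :=
    mem_map' Fin.valEmbedding
  have hm : (((mapEmbedding Fin.valEmbedding).toEmbedding S : Finset ℕ)) = S.map Fin.valEmbedding := rfl
  simp only [jacobiTrudiMatrix, Matrix.of_apply, Matrix.submatrix_apply, id, hm, hmem,
    Fin.val_castSucc]
  congr 1
  split_ifs
  · simp
    ring
  · simp

end JacobiTrudi

/-! ### Young diagrams of a given size and horizontal strips -/

namespace YoungDiagram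

theorem fst_lt_card {μ : YoungDiagram} {i j : ℕ} (h : (i, j) ∈ μ) : i < μ.card := by
  have h1 : μ.colLen 0 ≤ μ.card := by
    rw [colLen_eq_card]
    exact Finset.card_le_card (Finset.filter_subset _ _)
  have h2 := mem_iff_lt_colLen.1 h
  have h3 := μ.colLen_anti 0 j (Nat.zero_le _)
  omega

theorem rowLen_zero_le_card (μ : YoungDiagram) : μ.rowLen 0 ≤ μ.card := by
  rw [rowLen_eq_card]
  exact Finset.card_le_card (Finset.filter_subset _ _)

theorem colLen_eq_zero {μ : YoungDiagram} {j : ℕ} (h : μ.rowLen 0 ≤ j) : μ.colLen j = 0 := by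
  by_contra h0
  have h1 : (0, j) ∈ μ := mem_iff_lt_colLen.2 (Nat.pos_of_ne_zero h0)
  have := mem_iff_lt_rowLen.1 h1
  omega

theorem snd_lt_card {μ : YoungDiagram} {i j : ℕ} (h : (i, j) ∈ μ) : j < μ.card := by
  by_contra h0
  have h1 := mem_iff_lt_colLen.1 h
  rw [colLen_eq_zero (μ.rowLen_zero_le_card.trans (not_lt.1 h0))] at h1
  omega

theorem finite_setOf_card_eq (n : ℕ) : {μ : YoungDiagram | μ.card = n}.Finite := by
  refine Set.Finite.of_finite_image (f := YoungDiagram.cells) ?_ ?_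
  · refine ((Finset.range n ×ˢ Finset.range n).powerset.finite_toSet).subset ?_
    rintro _ ⟨μ, hμ, rfl⟩
    rw [Set.mem_ofPred_eq] at hμ
    simp only [Finset.coe_powerset, Set.mem_preimage, Set.mem_powerset_iff, Finset.coe_subset]
    rintro ⟨i, j⟩ hc
    rw [mem_cells] at hc
    simp only [Finset.mem_product, Finset.mem_range, ← hμ]
    exact ⟨fst_lt_card hc, snd_lt_card hc⟩
  · intro μ _ ν _ h
    exact YoungDiagram.ext h

/-- The finite set of Young diagrams with `n` cells. -/
def ofCard (n : ℕ) : Finset YoungDiagram := (finite_setOf_card_eq n).toFinset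

@[simp] theorem mem_ofCard {n : ℕ} {μ : YoungDiagram} : μ ∈ ofCard n ↔ μ.card = n := by
  simp [ofCard]

theorem card_eq_sum_colLen (μ : YoungDiagram) {T : ℕ} (hT : μ.rowLen 0 ≤ T) :
    μ.card = ∑ j ∈ Finset.range T, μ.colLen j := by
  have : ∀ c ∈ μ.cells, c.2 ∈ Finset.range T := by
    rintro ⟨i, j⟩ hc
    rw [mem_cells] at hc
    have h1 := mem_iff_lt_rowLen.1 hc
    have h2 := μ.rowLen_anti 0 i (Nat.zero_le _)
    simp only [Finset.mem_range]
    omega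
  rw [YoungDiagram.card, Finset.card_eq_sum_card_fiberwise this]
  exact Finset.sum_congr rfl fun j _ => (colLen_eq_card μ).symm

theorem ext_colLen {μ ν : YoungDiagram} (h : ∀ j, μ.colLen j = ν.colLen j) : μ = ν := by
  ext ⟨i, j⟩
  rw [mem_cells, mem_cells, mem_iff_lt_colLen, mem_iff_lt_colLen, h]

/-- The Young diagram with given column lengths. -/
def ofColLen (c : ℕ → ℕ) (hc : Antitone c) (T : ℕ) : YoungDiagram where
  cells := (Finset.range (c 0) ×ˢ Finset.range T).filter fun x => x.1 < c x.2
  isLowerSet := by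
    rintro ⟨i, j⟩ ⟨i', j'⟩ ⟨hi, hj⟩ h
    simp only [Finset.coe_filter, Finset.mem_product, Finset.mem_range, Set.mem_ofPred_eq] at h ⊢
    simp only at hi hj
    have := hc hj
    omega

theorem colLen_ofColLen (c : ℕ → ℕ) (hc : Antitone c) {T : ℕ} (hT : c T = 0) (j : ℕ) :
    (ofColLen c hc T).colLen j = c j := by
  have h : ∀ i, i < (ofColLen c hc T).colLen j ↔ i < c j := by
    intro i
    rw [← mem_iff_lt_colLen, ← mem_cells]
    simp only [ofColLen, Finset.mem_filter, Finset.mem_product, Finset.mem_range]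
    have h0 := hc (Nat.zero_le j)
    refine ⟨fun h => h.2, fun h => ⟨⟨by omega, ?_⟩, h⟩⟩
    by_contra hj
    have := hc (not_lt.1 hj)
    omega
  have h1 := h (c j)
  have h2 := h ((ofColLen c hc T).colLen j)
  omega

/-- `ν` is obtained from `μ` by adding a horizontal strip. -/
def IsHorizontalStrip (μ ν : YoungDiagram) : Prop :=
  μ ≤ ν ∧ ∀ j, ν.colLen j ≤ μ.colLen j + 1

theorem colLen_le_of_le {μ ν : YoungDiagram} (h : μ ≤ ν) (j : ℕ) : μ.colLen j ≤ ν.colLen j := by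
  by_contra h0
  have h1 : (ν.colLen j, j) ∈ μ := mem_iff_lt_colLen.2 (by omega)
  have h2 : (ν.colLen j, j) ∈ ν := h h1
  have := mem_iff_lt_colLen.1 h2
  omega

theorem le_of_colLen_le {μ ν : YoungDiagram} (h : ∀ j, μ.colLen j ≤ ν.colLen j) : μ ≤ ν := by
  rintro ⟨i, j⟩ hc
  exact mem_iff_lt_colLen.2 ((mem_iff_lt_colLen.1 hc).trans_le (h j))

end YoungDiagram

/-! ### The Pieri rule for Young diagrams. -/

section Pieri

variable {C : Type*} [CommRing C]

/-- The Jacobi–Trudi determinant `det (e_{μ'_i + j - i})` of a Young diagram. -/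
def schurDet (e : ℕ → C) (μ : YoungDiagram) : C := jacobiTrudi e (μ.rowLen 0) μ.colLen

theorem schurDet_eq_jacobiTrudi (e : ℕ → C) (he : e 0 = 1) (μ : YoungDiagram) {T : ℕ}
    (hT : μ.rowLen 0 ≤ T) : schurDet e μ = jacobiTrudi e T μ.colLen :=
  (jacobiTrudi_of_le e he hT _ fun _ hi => YoungDiagram.colLen_eq_zero hi).symm

open Finset Classical in
-- The determinant formula sums over sets $S$ of columns to be lengthened by one cell. If the new
-- lengths decrease weakly, they form a horizontal strip over $\mu$. If not, then
-- $\mu'_i=\mu'_{i+1}$ with $i\notin S$ and $i+1\in S$ for some $i$, and two rows agree. The size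
-- $T=|\mu|+k$ leaves room for all the diagrams $\nu$ at once.
theorem complete_mul_schurDet (e h : ℕ → C) (he : e 0 = 1) (hh : h 0 = 1)
    (hrel : ∀ k, ∑ p ∈ antidiagonal (k + 1), (-1) ^ p.1 * (h p.1 * e p.2) = 0)
    (k : ℕ) (μ : YoungDiagram) :
    h k * schurDet e μ =
      ∑ ν ∈ (YoungDiagram.ofCard (μ.card + k)).filter μ.IsHorizontalStrip, schurDet e ν := by
  set T := μ.card + k with hTdef
  have hμT : μ.rowLen 0 + k ≤ T := by have := μ.rowLen_zero_le_card; omega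
  rw [schurDet_eq_jacobiTrudi e he μ (T := T) (by omega),
    complete_mul_jacobiTrudi e h he hh hrel hμT _ fun _ hi => YoungDiagram.colLen_eq_zero hi]
  symm
  have hcol : ∀ ν ∈ (YoungDiagram.ofCard T).filter μ.IsHorizontalStrip, ∀ j,
      ν.colLen j = μ.colLen j +
        if j ∈ (range T).filter (fun j => ν.colLen j = μ.colLen j + 1) then 1 else 0 := by
    intro ν hν j
    simp only [mem_filter, YoungDiagram.mem_ofCard] at hν
    have h1 := YoungDiagram.colLen_le_of_le hν.2.1 j
    have h2 := hν.2.2 j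
    simp only [mem_filter, mem_range]
    by_cases hj : j < T
    · split_ifs <;> omega
    · have h3 : ν.colLen j = 0 :=
        YoungDiagram.colLen_eq_zero (by have := ν.rowLen_zero_le_card; omega)
      rw [if_neg fun h => hj h.1]
      omega
  refine sum_of_injOn (fun ν => (range T).filter fun j => ν.colLen j = μ.colLen j + 1)
    ?_ ?_ ?_ ?_
  · intro ν hν ν' hν' heq
    refine YoungDiagram.ext_colLen fun j => ?_
    simp only at heq
    rw [hcol ν hν, hcol ν' hν', heq]
  · intro ν hν
    have hcolν := hcol ν hν
    simp only [coe_filter, YoungDiagram.mem_ofCard, Set.mem_ofPred_eq] at hν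
    rw [mem_coe, mem_powersetCard]
    refine ⟨filter_subset _ _, ?_⟩
    beta_reduce
    have h1 := ν.card_eq_sum_colLen (T := T) (by have := ν.rowLen_zero_le_card; omega)
    rw [sum_congr rfl fun j _ => hcolν j, sum_add_distrib,
      ← μ.card_eq_sum_colLen (by omega), sum_boole, filter_mem_eq_inter,
      inter_eq_right.2 (filter_subset _ _), hν.1] at h1
    simp only [Nat.cast_id] at h1
    omega
  · intro S hS hnot
    have hS' := mem_powersetCard.1 hS
    set c : ℕ → ℕ := fun i => μ.colLen i + if i ∈ S then 1 else 0 with hc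
    by_cases hanti : Antitone c
    · refine absurd ?_ hnot
      have hcT : c T = 0 := by
        have : T ∉ S := fun h => by simpa using hS'.1 h
        simp only [hc, if_neg this, add_zero]
        exact YoungDiagram.colLen_eq_zero (by omega)
      have hcl := YoungDiagram.colLen_ofColLen c hanti hcT
      refine ⟨YoungDiagram.ofColLen c hanti T, ?_, ?_⟩
      · have hrow : (YoungDiagram.ofColLen c hanti T).rowLen 0 ≤ T := by
          by_contra h0
          have h1 := YoungDiagram.mem_iff_lt_rowLen.2 (not_le.1 h0)
          have h2 := YoungDiagram.mem_iff_lt_colLen.1 h1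
          rw [hcl, hcT] at h2
          omega
        simp only [coe_filter, YoungDiagram.mem_ofCard, Set.mem_ofPred_eq]
        refine ⟨?_, YoungDiagram.le_of_colLen_le fun j => ?_, fun j => ?_⟩
        · rw [YoungDiagram.card_eq_sum_colLen _ hrow, sum_congr rfl fun j _ => hcl j, hc,
            sum_add_distrib, ← μ.card_eq_sum_colLen (by omega), sum_boole, filter_mem_eq_inter,
            inter_eq_right.2 hS'.1, hS'.2]
          rfl
        · rw [hcl]
          exact Nat.le_add_right _ _
        · rw [hcl]
          simp only [hc]
          split_ifs <;> omega
      · ext j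
        simp only [mem_filter, mem_range, hcl]
        simp only [hc, add_right_inj]
        constructor
        · rintro ⟨_, h2⟩
          by_contra h3
          rw [if_neg h3] at h2
          omega
        · intro h2
          exact ⟨by simpa using hS'.1 h2, if_pos h2⟩
    · have hex : ∃ i, c i < c (i + 1) := by
        by_contra! h0
        exact hanti (antitone_nat_of_succ_le h0)
      obtain ⟨i, hi⟩ := hex
      have hle := μ.colLen_anti i (i + 1) (Nat.le_succ i)
      have hmem : i + 1 ∈ S := by
        by_contra h0
        simp only [hc, h0, if_false] at hi
        split_ifs at hi <;> omega
      refine jacobiTrudi_eq_zero e T c i (by simpa using hS'.1 hmem) ?_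
      simp only [hc, hmem, if_true] at hi ⊢
      split_ifs at hi ⊢ <;> omega
  · intro ν hν
    have h1 : ν.rowLen 0 ≤ T := by
      have := ν.rowLen_zero_le_card
      simp only [mem_filter, YoungDiagram.mem_ofCard] at hν
      omega
    rw [schurDet_eq_jacobiTrudi e he ν h1]
    congr 1
    funext j
    exact hcol ν hν j

end Pieri

/-! ### Semistandard tableaux and their contents -/

namespace SemistandardYoungTableau

variable {μ ν : YoungDiagram}

/-- The content of a tableau. -/
def content (T : SemistandardYoungTableau μ) : ℕ →₀ ℕ :=
  ∑ c ∈ μ.cells, Finsupp.single (T c.1 c.2) 1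

theorem content_apply (T : SemistandardYoungTableau μ) (a : ℕ) :
    T.content a = (μ.cells.filter fun c => T c.1 c.2 = a).card := by
  simp [content, Finsupp.finsetSum_apply, Finsupp.single_apply]

theorem content_degree (T : SemistandardYoungTableau μ) : T.content.degree = μ.card := by
  simp [content, YoungDiagram.card]

theorem mem_support_content (T : SemistandardYoungTableau μ) {i j : ℕ} (h : (i, j) ∈ μ) :
    T i j ∈ T.content.support := by
  rw [Finsupp.mem_support_iff, content_apply]
  exact Finset.card_ne_zero_of_mem (a := (i, j)) (by simp [h])

theorem finite_setOf_content_eq (μ : YoungDiagram) (m : ℕ →₀ ℕ) :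
    {T : SemistandardYoungTableau μ | T.content = m}.Finite := by
  let f : {T : SemistandardYoungTableau μ | T.content = m} → μ.cells → m.support := fun T c =>
    ⟨T.1 c.1.1 c.1.2, by
      have h := T.1.mem_support_content (i := c.1.1) (j := c.1.2) (YoungDiagram.mem_cells _ |>.1 c.2)
      have h' : T.1.content = m := T.2
      rwa [h'] at h⟩
  have hf : Function.Injective f := by
    intro T T' h
    ext i j
    by_cases hc : (i, j) ∈ μ
    · exact congrArg Subtype.val (congrFun h ⟨(i, j), (YoungDiagram.mem_cells _).2 hc⟩)
    · rw [T.1.zeros hc, T'.1.zeros hc]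
  have := Finite.of_injective f hf
  exact Set.toFinite _

/-- The number of tableaux of shape `μ` and content `m`. -/
def kostka (μ : YoungDiagram) (m : ℕ →₀ ℕ) : ℕ :=
  {T : SemistandardYoungTableau μ | T.content = m}.ncard

theorem kostka_eq_zero {m : ℕ →₀ ℕ} (h : μ.card ≠ m.degree) : kostka μ m = 0 := by
  rw [kostka, Set.ncard_eq_zero (finite_setOf_content_eq μ m), Set.eq_empty_iff_forall_notMem]
  intro T hT
  have hT' : T.content = m := hT
  rw [← hT', content_degree] at h
  exact h rfl

/-- The shape formed by the cells whose entry is less than `r`. -/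
def shapeBelow (T : SemistandardYoungTableau μ) (r : ℕ) : YoungDiagram where
  cells := μ.cells.filter fun c => T c.1 c.2 < r
  isLowerSet := by
    rintro ⟨i, j⟩ ⟨i', j'⟩ ⟨hi, hj⟩ h
    simp only [Finset.coe_filter, YoungDiagram.mem_cells, Set.mem_ofPred_eq] at h ⊢
    simp only at hi hj
    have h1 : (i', j) ∈ μ := μ.up_left_mem hi le_rfl h.1
    exact ⟨μ.up_left_mem hi hj h.1,
      (T.row_weak_of_le hj h1).trans_lt ((T.col_weak hi h.1).trans_lt h.2)⟩

theorem mem_shapeBelow {T : SemistandardYoungTableau μ} {r : ℕ} {c : ℕ × ℕ} :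
    c ∈ T.shapeBelow r ↔ c ∈ μ ∧ T c.1 c.2 < r := by
  rw [← YoungDiagram.mem_cells]
  simp [shapeBelow]

/-- The restriction of a tableau to a smaller shape. -/
def restrict (T : SemistandardYoungTableau ν) (h : μ ≤ ν) : SemistandardYoungTableau μ where
  entry i j := if (i, j) ∈ μ then T i j else 0
  row_weak' {i j1 j2} hj hc := by
    rw [if_pos hc, if_pos (μ.up_left_mem le_rfl hj.le hc)]
    exact T.row_weak hj (h hc)
  col_strict' {i1 i2 j} hi hc := by
    rw [if_pos hc, if_pos (μ.up_left_mem hi.le le_rfl hc)]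
    exact T.col_strict hi (h hc)
  zeros' hc := if_neg hc

theorem restrict_apply (T : SemistandardYoungTableau ν) (h : μ ≤ ν) (i j : ℕ) :
    T.restrict h i j = if (i, j) ∈ μ then T i j else 0 := rfl

/-- The extension of a tableau with entries less than `r` to a larger shape by the entry `r`. -/
def extend (T : SemistandardYoungTableau μ) (h : μ.IsHorizontalStrip ν) (r : ℕ)
    (hr : ∀ i j, (i, j) ∈ μ → T i j < r) : SemistandardYoungTableau ν where
  entry i j := if (i, j) ∈ μ then T i j else if (i, j) ∈ ν then r else 0
  row_weak' {i j1 j2} hj hc := by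
    rw [if_pos (ν.up_left_mem le_rfl hj.le hc), if_pos hc]
    split_ifs with h1 h2 h2
    · exact T.row_weak hj h2
    · exact (hr _ _ h1).le
    · exact absurd (μ.up_left_mem le_rfl hj.le h2) h1
    · exact le_rfl
  col_strict' {i1 i2 j} hi hc := by
    rw [if_pos (ν.up_left_mem hi.le le_rfl hc), if_pos hc]
    split_ifs with h1 h2 h2
    · exact T.col_strict hi h2
    · exact hr _ _ h1
    · exact absurd (μ.up_left_mem hi.le le_rfl h2) h1
    -- Two new cells in one column would contradict the strip condition.
    · rw [YoungDiagram.mem_iff_lt_colLen] at h1 hc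
      have := h.2 j
      omega
  zeros' {i j} hc := by
    rw [if_neg fun h' => hc (h.1 h'), if_neg hc]

theorem extend_apply (T : SemistandardYoungTableau μ) (h : μ.IsHorizontalStrip ν) (r : ℕ)
    (hr : ∀ i j, (i, j) ∈ μ → T i j < r) (i j : ℕ) :
    T.extend h r hr i j = if (i, j) ∈ μ then T i j else if (i, j) ∈ ν then r else 0 := rfl

theorem content_eq_sum_of_le (T : SemistandardYoungTableau ν) (h : μ ≤ ν) (T' : SemistandardYoungTableau μ)
    (r : ℕ) (h1 : ∀ i j, (i, j) ∈ μ → T i j = T' i j)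
    (h2 : ∀ i j, (i, j) ∈ ν → (i, j) ∉ μ → T i j = r) :
    T.content = T'.content + Finsupp.single r (ν.card - μ.card) := by
  have hsub : μ.cells ⊆ ν.cells := YoungDiagram.cells_subset_iff.2 h
  rw [content, content, ← Finset.sum_sdiff hsub, add_comm]
  congr 1
  · exact Finset.sum_congr rfl fun c hc => by rw [h1 c.1 c.2 ((YoungDiagram.mem_cells c).1 hc)]
  · have h3 : ∀ c ∈ ν.cells \ μ.cells, Finsupp.single (T c.1 c.2) 1 = Finsupp.single r 1 := by
      intro c hc
      rw [Finset.mem_sdiff, YoungDiagram.mem_cells, YoungDiagram.mem_cells] at hc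
      rw [h2 c.1 c.2 hc.1 hc.2]
    rw [Finset.sum_congr rfl h3, Finset.sum_const, Finset.card_sdiff_of_subset hsub]
    simp [YoungDiagram.card]

theorem shapeBelow_le (T : SemistandardYoungTableau ν) (r : ℕ) : T.shapeBelow r ≤ ν :=
  fun _ hc => (mem_shapeBelow.1 hc).1

open Finset Classical in
-- The entries of such a tableau are at most $r$. Deleting the cells with entry $r$ leaves a tableau
-- of content $m$, and strictness down columns allows at most one such cell per column, so the
-- deleted cells form a horizontal strip. Conversely, filling a strip with $r$ gives back the
-- tableau.
theorem kostka_add_single (ν : YoungDiagram) (m : ℕ →₀ ℕ) (r k : ℕ) (hm : ∀ a ∈ m.support, a < r)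
    (hν : ν.card = m.degree + k) :
    kostka ν (m + Finsupp.single r k) =
      ∑ μ ∈ (YoungDiagram.ofCard m.degree).filter fun μ => μ.IsHorizontalStrip ν, kostka μ m := by
  have hfin := finite_setOf_content_eq ν (m + Finsupp.single r k)
  have hle : ∀ T : SemistandardYoungTableau ν, T.content = m + Finsupp.single r k →
      ∀ i j, (i, j) ∈ ν → T i j < r + 1 := by
    intro T hT i j hc
    have h1 := T.mem_support_content hc
    rw [hT] at h1
    rcases mem_union.1 (Finsupp.support_add h1) with h2 | h2
    · exact (hm _ h2).trans (Nat.lt_succ_self r)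
    · have := Finsupp.support_single_subset h2
      rw [mem_singleton] at this
      omega
  have hrest : ∀ T : SemistandardYoungTableau ν, T.content = m + Finsupp.single r k →
      (T.restrict (T.shapeBelow_le r)).content = m := by
    intro T hT
    have h1 := T.content_eq_sum_of_le (T.shapeBelow_le r) (T.restrict (T.shapeBelow_le r)) r
      (fun i j hc => by rw [restrict_apply, if_pos hc])
      (fun i j hc hc' => by
        have := hle T hT i j hc
        rw [mem_shapeBelow, not_and, not_lt] at hc'
        have := hc' hc
        simp only at this
        omega)
    -- Comparing contents at $r$ shows that exactly $k$ cells were removed, after which the $r$-part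
    -- cancels.
    have h2 : (T.restrict (T.shapeBelow_le r)).content r = 0 := by
      rw [content_apply, card_eq_zero, filter_eq_empty_iff]
      intro c hc
      rw [YoungDiagram.mem_cells] at hc
      rw [restrict_apply, if_pos hc]
      exact (mem_shapeBelow.1 hc).2.ne
    have h3 : m r = 0 := by
      by_contra h0
      exact (hm r (Finsupp.mem_support_iff.2 h0)).false
    rw [hT] at h1
    have h4 := DFunLike.congr_fun h1 r
    rw [Finsupp.add_apply, Finsupp.add_apply, h2, h3, Finsupp.single_eq_same,
      Finsupp.single_eq_same] at h4
    rw [zero_add, zero_add] at h4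
    rw [← h4] at h1
    exact (add_right_cancel h1).symm
  have hmaps : ∀ T ∈ hfin.toFinset, T.shapeBelow r ∈
      (YoungDiagram.ofCard m.degree).filter fun μ => μ.IsHorizontalStrip ν := by
    intro T hT
    have hT' : T.content = m + Finsupp.single r k := by simpa using hT
    rw [mem_filter, YoungDiagram.mem_ofCard]
    refine ⟨by rw [← hrest T hT', content_degree], T.shapeBelow_le r, fun j => ?_⟩
    by_contra h0
    rw [not_le] at h0
    have h1 : ((T.shapeBelow r).colLen j + 1, j) ∈ ν := YoungDiagram.mem_iff_lt_colLen.2 h0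
    have h2 := hle T hT' _ _ h1
    have h3 := T.col_strict (lt_add_one ((T.shapeBelow r).colLen j)) h1
    have h4 : ((T.shapeBelow r).colLen j, j) ∈ T.shapeBelow r :=
      mem_shapeBelow.2 ⟨ν.up_left_mem (Nat.le_succ _) le_rfl h1, by simp only; omega⟩
    exact (YoungDiagram.mem_iff_lt_colLen.1 h4).false
  rw [kostka, Set.ncard_eq_toFinset_card _ hfin, card_eq_sum_card_fiberwise hmaps]
  refine sum_congr rfl fun μ hμ => ?_
  rw [mem_filter, YoungDiagram.mem_ofCard] at hμ
  obtain ⟨hμc, hμν⟩ := hμ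
  rw [kostka, Set.ncard_eq_toFinset_card _ (finite_setOf_content_eq μ m)]
  have hr : ∀ T : SemistandardYoungTableau μ, T.content = m → ∀ i j, (i, j) ∈ μ → T i j < r :=
    fun T hT i j hc => hm _ (hT ▸ T.mem_support_content hc)
  refine card_bij' (fun T _ => T.restrict hμν.1)
    (fun T hT => T.extend hμν r (hr T (by simpa using hT))) ?_ ?_ ?_ ?_
  · intro T hT
    simp only [mem_filter, Set.Finite.mem_toFinset, Set.mem_ofPred_eq] at hT ⊢
    obtain ⟨hT, rfl⟩ := hT
    exact hrest T hT
  · intro T hT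
    have hT' : T.content = m := by simpa using hT
    simp only [mem_filter, Set.Finite.mem_toFinset, Set.mem_ofPred_eq]
    constructor
    · rw [content_eq_sum_of_le _ hμν.1 T r
        (fun i j hc => by rw [extend_apply, if_pos hc])
        (fun i j hc hc' => by rw [extend_apply, if_neg hc', if_pos hc]), hT']
      congr 2
      omega
    · ext ⟨i, j⟩
      rw [YoungDiagram.mem_cells, YoungDiagram.mem_cells, mem_shapeBelow]
      simp only [extend_apply]
      constructor
      · rintro ⟨h1, h2⟩
        by_contra h3
        rw [if_neg h3, if_pos h1] at h2
        exact h2.false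
      · intro h1
        rw [if_pos h1]
        exact ⟨hμν.1 h1, hr T hT' i j h1⟩
  · intro T hT
    have hT' := hT
    simp only [mem_filter, Set.Finite.mem_toFinset, Set.mem_ofPred_eq] at hT'
    obtain ⟨hT', rfl⟩ := hT'
    ext i j
    rw [extend_apply, restrict_apply]
    split_ifs with h1 h2
    · rfl
    · have h3 := hle T hT' i j h2
      rw [mem_shapeBelow, not_and, not_lt] at h1
      have h4 := h1 h2
      simp only at h4
      omega
    · exact (T.zeros h2).symm
  · intro T hT
    ext i j
    rw [restrict_apply, extend_apply]
    split_ifs with h1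
    · rfl
    · exact (T.zeros h1).symm

/-! ### Complete functions in terms of Jacobi–Trudi determinants -/

open Finset Classical in
-- Induction on $m$, adding its largest index last. Multiplication by $h_k$ adds a horizontal strip
-- by the Pieri rule, and the Kostka numbers satisfy the matching recursion `kostka_add_single`.
theorem prod_complete_eq_sum_kostka {C : Type*} [CommRing C] (e h : ℕ → C) (he : e 0 = 1)
    (hh : h 0 = 1)
    (hrel : ∀ k, ∑ p ∈ antidiagonal (k + 1), (-1) ^ p.1 * (h p.1 * e p.2) = 0) (m : ℕ →₀ ℕ) :
    (m.prod fun _ k => h k) =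
      ∑ μ ∈ YoungDiagram.ofCard m.degree, (kostka μ m : C) * schurDet e μ := by
  induction m using Finsupp.induction_on_max with
  | zero =>
    have h0 : YoungDiagram.ofCard 0 = {⊥} := by
      ext μ
      rw [YoungDiagram.mem_ofCard, mem_singleton, YoungDiagram.card, card_eq_zero]
      constructor
      · intro h
        exact YoungDiagram.ext h
      · rintro rfl
        rfl
    have h1 : kostka ⊥ 0 = 1 := by
      rw [kostka, Set.ncard_eq_one]
      refine ⟨highestWeight ⊥, ?_⟩
      ext T
      constructor
      · intro _
        ext i j
        rw [T.zeros (YoungDiagram.notMem_bot _), zeros _ (YoungDiagram.notMem_bot _)]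
      · rintro rfl
        simp [content]
    have h2 : schurDet e ⊥ = 1 := by
      have : (⊥ : YoungDiagram).rowLen 0 = 0 :=
        Nat.le_zero.1 ((YoungDiagram.rowLen_zero_le_card ⊥).trans (by simp [YoungDiagram.card]))
      rw [schurDet, this, jacobiTrudi]
      simp
    simp [h0, h1, h2]
  | single_add r k m hm hk ih =>
    have hdisj : Disjoint (Finsupp.single r k).support m.support := by
      rw [Finset.disjoint_left]
      intro x hx hx'
      rw [mem_singleton.1 (Finsupp.support_single_subset hx)] at hx'
      exact (hm r hx').false
    rw [Finsupp.prod_add_index_of_disjoint hdisj, Finsupp.prod_single_index hh, ih, mul_sum]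
    have hdeg : (Finsupp.single r k + m).degree = m.degree + k := by
      rw [map_add, Finsupp.degree_single, add_comm]
    have h1 : ∀ μ ∈ YoungDiagram.ofCard m.degree, h k * ((kostka μ m : C) * schurDet e μ) =
        ∑ ν ∈ YoungDiagram.ofCard (m.degree + k),
          if μ.IsHorizontalStrip ν then (kostka μ m : C) * schurDet e ν else 0 := by
      intro μ hμ
      rw [YoungDiagram.mem_ofCard] at hμ
      rw [mul_left_comm, complete_mul_schurDet e h he hh hrel, mul_sum, hμ, sum_filter]
    rw [sum_congr rfl h1, sum_comm, hdeg]
    refine sum_congr rfl fun ν hν => ?_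
    rw [YoungDiagram.mem_ofCard] at hν
    rw [add_comm (Finsupp.single r k), kostka_add_single ν m r k hm hν, ← sum_filter, Nat.cast_sum,
      sum_mul]

end SemistandardYoungTableau

/-! ### Linear independence of the Schur functions -/

namespace SemistandardYoungTableau

variable {μ ν : YoungDiagram}

theorem le_apply (T : SemistandardYoungTableau μ) {i j : ℕ} (h : (i, j) ∈ μ) : i ≤ T i j := by
  induction i with
  | zero => exact Nat.zero_le _
  | succ i ih =>
    have h1 := ih (μ.up_left_mem (Nat.le_succ i) le_rfl h)
    have h2 := T.col_strict (lt_add_one i) h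
    omega

/-- The sum of the entries of a tableau with content `m`. -/
def entrySum (m : ℕ →₀ ℕ) : ℕ := m.sum fun a k => k * a

theorem entrySum_content (T : SemistandardYoungTableau μ) :
    entrySum T.content = ∑ c ∈ μ.cells, T c.1 c.2 := by
  rw [entrySum, content, ← Finsupp.sum_finsetSum_index]
  · simp
  · simp
  · intros
    ring

theorem content_highestWeight_apply (μ : YoungDiagram) (i : ℕ) :
    (highestWeight μ).content i = μ.rowLen i := by
  rw [content_apply, YoungDiagram.rowLen_eq_card, YoungDiagram.row]
  congr 1
  refine Finset.filter_congr fun c hc => ?_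
  rw [YoungDiagram.mem_cells] at hc
  simp [hc]

theorem content_highestWeight_injective :
    Function.Injective fun μ : YoungDiagram => (highestWeight μ).content := by
  intro μ ν h
  ext ⟨i, j⟩
  have h' := DFunLike.congr_fun h i
  simp only [content_highestWeight_apply] at h'
  rw [YoungDiagram.mem_cells, YoungDiagram.mem_cells, YoungDiagram.mem_iff_lt_rowLen,
    YoungDiagram.mem_iff_lt_rowLen, h']

theorem kostka_highestWeight_ne_zero (μ : YoungDiagram) :
    kostka μ (highestWeight μ).content ≠ 0 := by
  rw [kostka]
  exact Set.ncard_ne_zero_of_mem (a := highestWeight μ) rfl (finite_setOf_content_eq _ _)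

/-- An entry in row $i$ is at least $i$, so the highest weight tableau has the least entry sum among
the tableaux of shape $\mu$, and equality forces its content. That content determines the shape. The
entry sum thus makes the Kostka matrix triangular, without the dominance order. -/
theorem entrySum_lt_of_kostka_ne_zero (h : kostka μ (highestWeight ν).content ≠ 0) (hne : μ ≠ ν) :
    entrySum (highestWeight μ).content < entrySum (highestWeight ν).content := by
  obtain ⟨T, hT⟩ := Set.nonempty_of_ncard_ne_zero h
  have hT' : T.content = (highestWeight ν).content := hT
  have hle : ∀ c ∈ μ.cells, highestWeight μ c.1 c.2 ≤ T c.1 c.2 := by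
    intro c hc
    rw [YoungDiagram.mem_cells] at hc
    rw [highestWeight_apply, if_pos hc]
    exact T.le_apply hc
  rw [← hT', entrySum_content, entrySum_content]
  refine lt_of_le_of_ne (Finset.sum_le_sum hle) fun heq => ?_
  rw [Finset.sum_eq_sum_iff_of_le hle] at heq
  refine hne (content_highestWeight_injective ?_)
  beta_reduce
  rw [← hT']
  exact Finset.sum_congr rfl fun c hc => by rw [heq c hc]

end SemistandardYoungTableau

open SemistandardYoungTableau in
theorem coeff_schurFunction (μ : YoungDiagram) (m : ℕ →₀ ℕ) :
    MvPowerSeries.coeff m (schurFunction μ) = kostka μ m := rfl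

theorem coeff_sum_smul_schurFunction (c : YoungDiagram →₀ ℤ) (m : ℕ →₀ ℕ) :
    MvPowerSeries.coeff m (c.sum fun μ a => a • schurFunction μ) =
      c.sum fun μ a => a * SemistandardYoungTableau.kostka μ m := by
  rw [Finsupp.sum, map_sum]
  refine Finset.sum_congr rfl fun μ _ => ?_
  rw [map_zsmul, coeff_schurFunction, smul_eq_mul]

open SemistandardYoungTableau in
/-- The Schur functions are linearly independent over the integers. -/
theorem linearIndependent_schurFunction : LinearIndependent ℤ schurFunction := by
  rw [linearIndependent_iff]
  intro c hc
  by_contra hne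
  -- For $\nu$ of least entry sum in the support, triangularity leaves only $c_\nu K_{\nu\nu}$ in
  -- the coefficient of $x^\nu$.
  obtain ⟨ν, hν, hmin⟩ := Finset.exists_min_image c.support
    (fun μ => entrySum (highestWeight μ).content) (Finsupp.support_nonempty_iff.2 hne)
  have h1 := congrArg (MvPowerSeries.coeff (highestWeight ν).content) hc
  rw [Finsupp.linearCombination_apply, coeff_sum_smul_schurFunction, map_zero, Finsupp.sum,
    Finset.sum_eq_single ν] at h1
  · rcases mul_eq_zero.1 h1 with h2 | h2
    · exact Finsupp.mem_support_iff.1 hν h2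
    · exact kostka_highestWeight_ne_zero ν (by exact_mod_cast h2)
  · intro μ hμ hμν
    by_contra h0
    have h2 : kostka μ (highestWeight ν).content ≠ 0 := fun h => h0 (by rw [h]; simp)
    exact (hmin μ hμ).not_gt (entrySum_lt_of_kostka_ne_zero h2 hμν)
  · intro h
    exact absurd hν h

/-! ### Words in the free associative algebra -/

section Words

variable {N : ℕ}

theorem wordMonomial_mul (v w : KRWord N) :
    wordMonomial v * wordMonomial w = wordMonomial (v ++ w) := by
  rw [wordMonomial, wordMonomial, MonoidAlgebra.single_mul_single, mul_one, wordMonomial,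
    FreeMonoid.ofList_append]

theorem wordMonomial_nil : (wordMonomial [] : FreeAlg N) = 1 := rfl

theorem coeff_wordMonomial (v w : KRWord N) :
    (wordMonomial v).coeff (FreeMonoid.ofList w) = if v = w then 1 else 0 := by
  classical
  rw [wordMonomial, MonoidAlgebra.coeff_single, Finsupp.single_apply]
  simp

theorem coeff_mul_wordMonomial (f : FreeAlg N) (x y v : KRWord N) (h : v.length = y.length) :
    (f * wordMonomial v).coeff (FreeMonoid.ofList (x ++ y)) =
      if v = y then f.coeff (FreeMonoid.ofList x) else 0 := by
  split_ifs with hv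
  · subst hv
    rw [wordMonomial, MonoidAlgebra.coeff_mul_single_eq_coeff_mul (FreeMonoid.ofList x), mul_one]
    intro m _
    rw [FreeMonoid.ofList_append]
    exact mul_left_inj _
  · rw [wordMonomial, MonoidAlgebra.coeff_mul_single_of_forall_mul_ne]
    intro d hd
    have hd' : FreeMonoid.toList d ++ v = x ++ y := congrArg FreeMonoid.toList hd
    exact hv (List.append_inj_right' hd' h)

theorem coeff_mul_wordMonomial_of_length_lt (f : FreeAlg N) (w v : KRWord N)
    (h : w.length < v.length) : (f * wordMonomial v).coeff (FreeMonoid.ofList w) = 0 := by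
  rw [wordMonomial, MonoidAlgebra.coeff_mul_single_of_forall_mul_ne]
  intro d hd
  have hd' : FreeMonoid.toList d ++ v = w := congrArg FreeMonoid.toList hd
  have := congrArg List.length hd'
  rw [List.length_append] at this
  omega

/-- The generator `u_a` of the free associative algebra. -/
def letterMonomial (a : Fin N) : FreeAlg N := wordMonomial [a]

theorem listElementary_letterMonomial (l : List (Fin N)) (k : ℕ) :
    listElementary letterMonomial l k = ((l.sublistsLen k).map wordMonomial).sum := by
  induction l generalizing k with
  | nil => cases k <;> simp [wordMonomial_nil]
  | cons a l ih =>
    cases k with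
    | zero => simp [wordMonomial_nil]
    | succ k =>
      rw [listElementary_cons_succ, List.sublistsLen_succ_cons, List.map_append, List.sum_append,
        ih, ih, ← List.sum_map_mul_left, List.map_map]
      congr 2
      refine List.map_congr_left fun v _ => ?_
      rw [letterMonomial, wordMonomial_mul, Function.comp_apply, List.singleton_append]

theorem listComplete_letterMonomial (l : List (Fin N)) (k : ℕ) :
    listComplete letterMonomial l k =
      ((l.sublistsLen k).map fun v => wordMonomial v.reverse).sum := by
  induction l generalizing k with
  | nil => cases k <;> simp [wordMonomial_nil]
  | cons a l ih =>
    cases k with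
    | zero => simp [wordMonomial_nil]
    | succ k =>
      rw [listComplete_cons_succ, List.sublistsLen_succ_cons, List.map_append, List.sum_append,
        ih, ih, ← List.sum_map_mul_right, List.map_map]
      congr 2
      refine List.map_congr_left fun v _ => ?_
      rw [letterMonomial, wordMonomial_mul, Function.comp_apply, List.reverse_cons]

/-- The letters in decreasing order. -/
def letters (N : ℕ) : List (Fin N) := (List.finRange N).reverse

theorem pairwise_letters (N : ℕ) : (letters N).Pairwise (· > ·) := by
  rw [letters, List.pairwise_reverse]
  exact List.pairwise_lt_finRange N

theorem nodup_letters (N : ℕ) : (letters N).Nodup :=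
  (pairwise_letters N).imp fun h => h.ne'

theorem sublist_letters_iff (w : KRWord N) : w.Sublist (letters N) ↔ w.Pairwise (· > ·) := by
  refine ⟨fun h => (pairwise_letters N).sublist h, fun h => ?_⟩
  refine List.sublist_of_subperm_of_pairwise (r := (· > ·)) ?_ h (pairwise_letters N)
  exact List.subperm_of_subset (h.imp fun h => h.ne') fun a _ => by simp [letters]

open Finset in
theorem ncElementary_eq (d : ℤ) :
    ncElementary N d = extendByZero (listElementary letterMonomial (letters N)) d := by
  classical
  rw [ncElementary, extendByZero]
  split_ifs
  · rw [listElementary_letterMonomial,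
      ← List.sum_toFinset _ (List.nodup_sublistsLen _ (nodup_letters N))]
    refine sum_bij (fun i _ => List.ofFn i) ?_ ?_ ?_ ?_
    · intro i hi
      rw [List.mem_toFinset, List.mem_sublistsLen, sublist_letters_iff, List.pairwise_ofFn]
      exact ⟨fun a b hab => (mem_filter.1 hi).2 hab, List.length_ofFn⟩
    · intro i _ j _ h
      exact List.ofFn_injective h
    · intro w hw
      rw [List.mem_toFinset, List.mem_sublistsLen, sublist_letters_iff] at hw
      obtain ⟨h1, h2⟩ := hw
      refine ⟨fun j => w.get (j.cast h2.symm), ?_, ?_⟩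
      · rw [mem_filter]
        refine ⟨mem_univ _, fun a b hab => ?_⟩
        exact List.pairwise_iff_get.1 h1 _ _ hab
      · refine List.ext_get (by simp [h2]) fun n h3 h4 => ?_
        simp
    · intro _ _
      rfl
  · rfl

theorem coeff_mul_listComplete (f : FreeAlg N) (x y : KRWord N) :
    (f * listComplete letterMonomial (letters N) y.length).coeff (FreeMonoid.ofList (x ++ y)) =
      if y.Pairwise (· < ·) then f.coeff (FreeMonoid.ofList x) else 0 := by
  classical
  rw [listComplete_letterMonomial,
    ← List.sum_toFinset _ (List.nodup_sublistsLen _ (nodup_letters N)), Finset.mul_sum,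
    MonoidAlgebra.coeff_sum, Finsupp.finsetSum_apply]
  have h1 : ∀ v ∈ ((letters N).sublistsLen y.length).toFinset,
      (f * wordMonomial v.reverse).coeff (FreeMonoid.ofList (x ++ y)) =
        if v = y.reverse then f.coeff (FreeMonoid.ofList x) else 0 := by
    intro v hv
    rw [List.mem_toFinset, List.mem_sublistsLen] at hv
    rw [coeff_mul_wordMonomial _ _ _ _ (by simp [hv.2])]
    simp only [List.reverse_eq_iff]
  rw [Finset.sum_congr rfl h1, Finset.sum_ite_eq']
  congr 1
  rw [List.mem_toFinset, List.mem_sublistsLen, sublist_letters_iff, List.pairwise_reverse]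
  simp

theorem coeff_mul_listComplete_of_length_lt (f : FreeAlg N) (w : KRWord N) {k : ℕ}
    (h : w.length < k) :
    (f * listComplete letterMonomial (letters N) k).coeff (FreeMonoid.ofList w) = 0 := by
  classical
  rw [listComplete_letterMonomial,
    ← List.sum_toFinset _ (List.nodup_sublistsLen _ (nodup_letters N)), Finset.mul_sum,
    MonoidAlgebra.coeff_sum, Finsupp.finsetSum_apply]
  refine Finset.sum_eq_zero fun v hv => coeff_mul_wordMonomial_of_length_lt _ _ _ ?_
  rw [List.mem_toFinset, List.mem_sublistsLen] at hv
  simpa [hv.2] using h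

/-! ### Coefficients of fundamental quasisymmetric functions -/

/-- The weakly increasing list over `{0, …, r - 1}` in which `i` occurs `m i` times. -/
def contentList (m : ℕ → ℕ) (r : ℕ) : List ℕ := (List.range r).flatMap fun i => List.replicate (m i) i

theorem contentList_succ (m : ℕ → ℕ) (r : ℕ) :
    contentList m (r + 1) = contentList m r ++ List.replicate (m r) r := by
  simp [contentList, List.range_succ]

theorem lt_of_mem_contentList {m : ℕ → ℕ} {r a : ℕ} (h : a ∈ contentList m r) : a < r := by
  simp only [contentList, List.mem_flatMap, List.mem_range, List.mem_replicate] at h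
  obtain ⟨i, hi, -, rfl⟩ := h
  exact hi

theorem pairwise_contentList (m : ℕ → ℕ) (r : ℕ) : (contentList m r).Pairwise (· ≤ ·) := by
  induction r with
  | zero => simp [contentList]
  | succ r ih =>
    rw [contentList_succ, List.pairwise_append]
    refine ⟨ih, by simp [List.pairwise_replicate], fun a ha b hb => ?_⟩
    rw [List.eq_of_mem_replicate hb]
    exact (lt_of_mem_contentList ha).le

theorem count_contentList (m : ℕ → ℕ) (r a : ℕ) :
    (contentList m r).count a = if a < r then m a else 0 := by
  induction r with
  | zero => simp [contentList]
  | succ r ih =>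
    rw [contentList_succ, List.count_append, ih, List.count_replicate]
    by_cases h : r = a
    · subst h
      simp
    · have : (a < r + 1) ↔ a < r := by omega
      simp [h, this]

/-- The strict lexicographic order on pairs. -/
def LexLT (p q : ℕ × Fin N) : Prop := p.1 < q.1 ∨ p.1 = q.1 ∧ p.2 < q.2

instance : Trans (LexLT (N := N)) LexLT LexLT where
  trans {p q r} h1 h2 := by
    simp only [LexLT, Fin.lt_def] at *
    omega

theorem pairwise_zip_replicate (r : ℕ) (y : KRWord N) :
    ((List.replicate y.length r).zip y).Pairwise LexLT ↔ y.Pairwise (· < ·) := by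
  have : (List.replicate y.length r).zip y = y.map fun a => (r, a) := by
    induction y with
    | nil => rfl
    | cons a y ih => simpa [List.replicate_succ] using ih
  rw [this, List.pairwise_map]
  simp [LexLT]

open Classical in
-- A word occurs in the product exactly when its consecutive blocks of lengths $m_0,\dots,m_{r-1}$
-- exhaust it and each increases strictly. Labelling every letter with the index of its block turns
-- this into strict lexicographic increase of the pairs.
theorem coeff_prod_listComplete (m : ℕ → ℕ) (r : ℕ) (w : KRWord N) :
    (((List.range r).map fun i => listComplete letterMonomial (letters N) (m i)).prod).coeff
        (FreeMonoid.ofList w) =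
      if (contentList m r).length = w.length ∧ ((contentList m r).zip w).Pairwise LexLT
      then 1 else 0 := by
  induction r generalizing w with
  | zero =>
    have := coeff_wordMonomial ([] : KRWord N) w
    rw [wordMonomial_nil] at this
    rw [List.range_zero, List.map_nil, List.prod_nil, this]
    congr 1
    simp [contentList, eq_comm]
  | succ r ih =>
    rw [List.range_succ, List.map_append, List.prod_append, List.map_singleton,
      List.prod_singleton, contentList_succ, List.length_append, List.length_replicate]
    by_cases hlt : w.length < m r
    · rw [coeff_mul_listComplete_of_length_lt _ _ hlt, if_neg fun h => by omega]
    -- The last block consists of the last $m_r$ letters.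
    · obtain ⟨x, y, rfl, hy⟩ : ∃ x y, w = x ++ y ∧ y.length = m r :=
        ⟨w.take (w.length - m r), w.drop (w.length - m r), by simp, by simp; omega⟩
      rw [← hy, coeff_mul_listComplete, ih, ← ite_and]
      congr 1
      rw [List.length_append, Nat.add_right_cancel_iff, eq_iff_iff]
      by_cases hlen : (contentList m r).length = x.length
      · rw [List.zip_append hlen, List.pairwise_append, pairwise_zip_replicate]
        have hcross : ∀ a ∈ (contentList m r).zip x, ∀ b ∈ (List.replicate y.length r).zip y,
            LexLT a b := by
          intro a ha b hb
          refine Or.inl ?_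
          rw [List.eq_of_mem_replicate (List.of_mem_zip hb).1]
          exact lt_of_mem_contentList (List.of_mem_zip ha).1
        tauto
      · simp [hlen]

/-- A weakly increasing sequence is determined by its content. As the letters of $w$ are distinct, a
position that is not a descent is a strict ascent, so the descent condition says that consecutive
pairs $(i_j,w_j)$ increase lexicographically; transitivity extends this to all pairs. -/
theorem mem_fundamental_iff {n : ℕ} (w : KRWord N) (hw : w.length = n) (hnd : w.Nodup)
    (m : ℕ →₀ ℕ) (r : ℕ) (hr : ∀ a ∈ m.support, a < r) (i : Fin n → ℕ) :
    (Monotone i ∧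
      (∀ (j : ℕ) (h : j + 1 < n), j + 1 ∈ descentSet w →
        i ⟨j, Nat.lt_of_succ_lt h⟩ < i ⟨j + 1, h⟩) ∧
      ∑ j, Finsupp.single (i j) 1 = m) ↔
    List.ofFn i = contentList m r ∧ ((contentList m r).zip w).Pairwise LexLT := by
  have hcount : ∀ a, (List.ofFn i).count a = (∑ j, Finsupp.single (i j) 1 : ℕ →₀ ℕ) a := by
    intro a
    rw [Finsupp.finsetSum_apply, ← List.sum_ofFn (f := fun j => Finsupp.single (i j) 1 a)]
    have : (List.ofFn fun j => Finsupp.single (i j) 1 a) =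
        (List.ofFn i).map fun b => if b = a then 1 else 0 := by
      rw [List.map_ofFn]
      congr 1
      funext j
      simp [Finsupp.single_apply]
    rw [this]
    generalize List.ofFn i = l
    induction l with
    | nil => rfl
    | cons b l ih =>
      rw [List.count_cons, ih, List.map_cons, List.sum_cons, add_comm]
      simp
  have hcontent : ∑ j, Finsupp.single (i j) 1 = m ↔ (List.ofFn i).Perm (contentList m r) := by
    rw [List.perm_iff_count, Finsupp.ext_iff]
    refine forall_congr' fun a => ?_
    rw [hcount, count_contentList]
    have : (if a < r then m a else 0) = m a := by
      split_ifs with h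
      · rfl
      · by_contra h0
        exact h (hr a (Finsupp.mem_support_iff.2 (Ne.symm h0)))
    rw [this]
  have hmono : Monotone i ↔ (List.ofFn i).Pairwise (· ≤ ·) := by
    rw [List.pairwise_ofFn]
    exact ⟨fun h _ _ hab => h hab.le, fun h a b hab => by
      rcases hab.eq_or_lt with rfl | hab
      · exact le_rfl
      · exact h hab⟩
  have hdes : Monotone i → ((∀ (j : ℕ) (h : j + 1 < n), j + 1 ∈ descentSet w →
        i ⟨j, Nat.lt_of_succ_lt h⟩ < i ⟨j + 1, h⟩) ↔
      ((List.ofFn i).zip w).Pairwise LexLT) := by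
    intro hi
    rw [← List.isChain_iff_pairwise, List.isChain_iff_getElem]
    have hlen : ((List.ofFn i).zip w).length = n := by simp [hw]
    suffices hkey : ∀ (j : ℕ) (hj : j + 1 < n), (j + 1 ∈ descentSet w →
        i ⟨j, Nat.lt_of_succ_lt hj⟩ < i ⟨j + 1, hj⟩) ↔
        LexLT (((List.ofFn i).zip w)[j]'(by omega)) (((List.ofFn i).zip w)[j + 1]'(by omega)) from
      ⟨fun h j hj => (hkey j (hlen ▸ hj)).1 (h j _),
        fun h j hj => (hkey j hj).2 (h j (hlen.symm ▸ hj))⟩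
    intro j hj
    have hle : i ⟨j, Nat.lt_of_succ_lt hj⟩ ≤ i ⟨j + 1, hj⟩ := hi (by simp)
    have hne : w[j]'(by omega) ≠ w[j + 1]'(by omega) := by
      intro h
      have := (List.Nodup.getElem_inj_iff hnd).1 h
      omega
    simp only [List.getElem_zip, List.getElem_ofFn, LexLT, descentSet, Set.mem_ofPred_eq,
      Nat.le_add_left, true_and, Nat.add_sub_cancel]
    constructor
    · intro h
      rcases lt_or_gt_of_ne hne with h1 | h1
      · rcases hle.lt_or_eq with h2 | h2
        · exact Or.inl h2
        · exact Or.inr ⟨h2, h1⟩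
      · exact Or.inl (h ⟨by omega, h1⟩)
    · rintro h ⟨_, h1⟩
      rcases h with h | ⟨_, h⟩
      · exact h
      · exact absurd h1 h.not_gt
  constructor
  · rintro ⟨h1, h2, h3⟩
    have h4 := List.Perm.eq_of_pairwise' (hmono.1 h1) (pairwise_contentList m r) (hcontent.1 h3)
    exact ⟨h4, h4 ▸ (hdes h1).1 h2⟩
  · rintro ⟨h1, h2⟩
    have h3 : Monotone i := hmono.2 (h1 ▸ pairwise_contentList m r)
    exact ⟨h3, (hdes h3).2 (h1 ▸ h2), hcontent.2 (h1 ▸ List.Perm.refl _)⟩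

open Classical in
-- At most one sequence has monomial $x^m$, so both sides are 0 or 1, decided by the same condition.
-- This is the bridge from quasisymmetric functions to the $h_k(\mathbf u)$.
theorem coeff_fundamentalQuasisymmetric {n : ℕ} (w : KRWord N) (hw : w.length = n) (hnd : w.Nodup)
    (m : ℕ →₀ ℕ) (r : ℕ) (hr : ∀ a ∈ m.support, a < r) :
    MvPowerSeries.coeff m (fundamentalQuasisymmetric n (descentSet w)) =
      (((List.range r).map fun i => listComplete letterMonomial (letters N) (m i)).prod).coeff
        (FreeMonoid.ofList w) := by
  rw [coeff_prod_listComplete]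
  change ((Set.ncard _ : ℕ) : ℤ) = _
  simp only [mem_fundamental_iff w hw hnd m r hr]
  split_ifs with h
  · obtain ⟨h1, h2⟩ := h
    have h3 : (contentList m r).length = n := h1.trans hw
    rw [Nat.cast_eq_one, Set.ncard_eq_one]
    refine ⟨fun j => (contentList m r).get (j.cast h3.symm), ?_⟩
    have h4 : List.ofFn (fun j : Fin n => (contentList m r).get (j.cast h3.symm)) =
        contentList m r :=
      List.ext_get (by simp [h3]) fun k _ _ => by simp
    ext i
    rw [Set.mem_singleton_iff]
    constructor
    · intro hi
      exact List.ofFn_injective (hi.1.trans h4.symm)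
    · rintro rfl
      exact ⟨h4, h2⟩
  · rw [Nat.cast_eq_zero]
    rw [← Set.ncard_empty (α := Fin n → ℕ)]
    congr 1
    rw [Set.eq_empty_iff_forall_notMem]
    rintro i ⟨h1, h2⟩
    refine h ⟨?_, h2⟩
    rw [← h1, List.length_ofFn, hw]

end Words

/-! ### Homogeneity of the noncommutative Schur functions -/

section Homogeneous

variable {N : ℕ}

/-- The homogeneous elements of degree `d` of the free associative algebra. -/
def homogeneousPart (N : ℕ) (d : ℤ) : AddSubgroup (FreeAlg N) :=
  AddSubgroup.closure {f | ∃ w : KRWord N, (w.length : ℤ) = d ∧ wordMonomial w = f}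

theorem wordMonomial_mem_homogeneousPart (w : KRWord N) {d : ℤ} (h : (w.length : ℤ) = d) :
    wordMonomial w ∈ homogeneousPart N d :=
  AddSubgroup.subset_closure ⟨w, h, rfl⟩

theorem mul_mem_homogeneousPart {f g : FreeAlg N} {d d' : ℤ} (hf : f ∈ homogeneousPart N d)
    (hg : g ∈ homogeneousPart N d') : f * g ∈ homogeneousPart N (d + d') := by
  induction hf using AddSubgroup.closure_induction with
  | mem f hf =>
    obtain ⟨v, hv, rfl⟩ := hf
    induction hg using AddSubgroup.closure_induction with
    | mem g hg =>
      obtain ⟨w, hw, rfl⟩ := hg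
      rw [wordMonomial_mul]
      refine wordMonomial_mem_homogeneousPart _ ?_
      rw [List.length_append]
      push_cast
      rw [hv, hw]
    | zero => rw [mul_zero]; exact zero_mem _
    | add _ _ _ _ h1 h2 => rw [mul_add]; exact add_mem h1 h2
    | neg _ _ h1 => rw [mul_neg]; exact neg_mem h1
  | zero => rw [zero_mul]; exact zero_mem _
  | add _ _ _ _ h1 h2 => rw [add_mul]; exact add_mem h1 h2
  | neg _ _ h1 => rw [neg_mul]; exact neg_mem h1

theorem ncElementary_mem_homogeneousPart (d : ℤ) : ncElementary N d ∈ homogeneousPart N d := by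
  classical
  rw [ncElementary]
  split_ifs with hd
  · refine sum_mem fun i _ => wordMonomial_mem_homogeneousPart _ ?_
    rw [List.length_ofFn]
    exact Int.toNat_of_nonneg hd
  · exact zero_mem _

theorem prod_ofFn_mem_homogeneousPart {t : ℕ} (f : Fin t → FreeAlg N) (d : Fin t → ℤ)
    (h : ∀ j, f j ∈ homogeneousPart N (d j)) :
    (List.ofFn f).prod ∈ homogeneousPart N (∑ j, d j) := by
  induction t with
  | zero => exact wordMonomial_mem_homogeneousPart [] (by simp)
  | succ t ih =>
    rw [List.ofFn_succ, List.prod_cons, Fin.sum_univ_succ]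
    exact mul_mem_homogeneousPart (h 0) (ih _ _ fun j => h j.succ)

/-- The shifts $\pi(j)-j$ sum to zero, so each term has degree $|\mu|$. Integer degrees spare a case
distinction, since $e_d=0$ for $d<0$ lies in every homogeneous part. Homogeneity is what makes the
Schur expansion finite. -/
theorem ncSchur_mem_homogeneousPart (μ : YoungDiagram) :
    ncSchur N μ ∈ homogeneousPart N μ.card := by
  rw [ncSchur]
  refine sum_mem fun π _ => zsmul_mem ?_ _
  have h := prod_ofFn_mem_homogeneousPart (N := N) (fun j : Fin (μ.rowLen 0) =>
    ncElementary N ((μ.colLen j : ℤ) + ((π j : ℕ) : ℤ) - ((j : ℕ) : ℤ))) _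
    fun j => ncElementary_mem_homogeneousPart _
  convert h using 2
  rw [Finset.sum_sub_distrib, Finset.sum_add_distrib,
    Equiv.sum_comp π (fun j : Fin (μ.rowLen 0) => ((j : ℕ) : ℤ)), add_sub_cancel_right,
    μ.card_eq_sum_colLen le_rfl, ← Fin.sum_univ_eq_sum_range (fun j => μ.colLen j)]
  push_cast
  rfl

end Homogeneous

/-! ### The functional attached to a partial D₀ graph -/

namespace PartialD0Graph

variable {N n : ℕ} (H : PartialD0Graph N n)

/-- The pairing with the sum of the vertices. -/
def functional : FreeAlg N →+ ℤ where
  toFun f := ∑ w ∈ H.verts, f.coeff (FreeMonoid.ofList w)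
  map_zero' := by simp
  map_add' f g := by simp [Finset.sum_add_distrib]

theorem functional_apply (f : FreeAlg N) :
    H.functional f = ∑ w ∈ H.verts, f.coeff (FreeMonoid.ofList w) := rfl

theorem functional_wordMonomial (w : KRWord N) :
    H.functional (wordMonomial w) = if w ∈ H.verts then 1 else 0 := by
  simp [functional_apply, coeff_wordMonomial]

theorem wordPairing_vertexSum (f : FreeAlg N) : wordPairing f H.vertexSum = H.functional f := by
  have h : ∀ w : KRWord N, H.vertexSum.coeff (FreeMonoid.ofList w) = if w ∈ H.verts then 1 else 0 := by
    intro w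
    simp only [vertexSum, MonoidAlgebra.coeff_sum, Finsupp.finsetSum_apply, coeff_wordMonomial,
      Finset.sum_ite_eq']
  induction f using MonoidAlgebra.induction_linear with
  | zero => simp [wordPairing]
  | add f g hf hg =>
    rw [map_add, ← hf, ← hg, wordPairing, MonoidAlgebra.coeff_add, Finsupp.sum_add_index']
    · rfl
    · simp
    · intros
      ring
  | single w r =>
    have h1 : MonoidAlgebra.single w r = r • wordMonomial (FreeMonoid.toList w) := by
      rw [wordMonomial, MonoidAlgebra.smul_single]
      simp
    rw [h1, map_zsmul, functional_wordMonomial, ← h, ← h1, wordPairing]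
    simp

theorem functional_eq_zero {f : FreeAlg N} {d : ℤ} (hf : f ∈ homogeneousPart N d) (hd : d ≠ n) :
    H.functional f = 0 := by
  induction hf using AddSubgroup.closure_induction with
  | mem f hf =>
    obtain ⟨w, hw, rfl⟩ := hf
    rw [functional_wordMonomial, if_neg]
    intro h
    rw [H.length_eq w h] at hw
    exact hd hw.symm
  | zero => exact map_zero _
  | add _ _ _ _ h1 h2 => rw [map_add, h1, h2, add_zero]
  | neg _ _ h1 => rw [map_neg, h1, neg_zero]

/-- Every one of the six possibilities balances $\{bac,cab\}$ against $\{bca,acb\}$; which pairs are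
edges does not matter. If the square has a repeated letter, none of its words is a vertex. -/
theorem functional_krSquare (v w : KRWord N) {a b c : Fin N} (hab : a < b) (hbc : b < c) :
    H.functional (wordMonomial (insertTriple v w b a c)) +
      H.functional (wordMonomial (insertTriple v w c a b)) =
    H.functional (wordMonomial (insertTriple v w b c a)) +
      H.functional (wordMonomial (insertTriple v w a c b)) := by
  simp only [functional_wordMonomial]
  by_cases hnd : (insertTriple v w a b c).Nodup
  · obtain ⟨p, hp, -⟩ := H.existsUnique_possibility v w a b c hab hbc hnd
    have hinj : ∀ x y z x' y' z', insertTriple v w x y z = insertTriple v w x' y' z' ↔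
        x = x' ∧ y = y' ∧ z = z' := by
      intro x y z x' y' z'
      simp [insertTriple]
    have hab' := hab.ne
    have hbc' := hbc.ne
    have hac' := (hab.trans hbc).ne
    set W : Set (KRWord N) := (H.verts : Set (KRWord N)) with hW
    have hmem : ∀ x, x ∈ H.verts ↔ x ∈ W := fun x => by rw [hW, Finset.mem_coe]
    simp only [hmem]
    have pair : ∀ s t : KRWord N, krSquare v w a b c ∩ W = {s, t} →
        ∀ x ∈ krSquare v w a b c, (x ∈ W ↔ x = s ∨ x = t) := by
      intro s t h x hx
      have : x ∈ krSquare v w a b c ∩ W ↔ x ∈ ({s, t} : Set (KRWord N)) := by rw [h]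
      simpa [hx] using this
    have m1 : insertTriple v w b a c ∈ krSquare v w a b c := by simp [krSquare]
    have m2 : insertTriple v w b c a ∈ krSquare v w a b c := by simp [krSquare]
    have m3 : insertTriple v w a c b ∈ krSquare v w a b c := by simp [krSquare]
    have m4 : insertTriple v w c a b ∈ krSquare v w a b c := by simp [krSquare]
    cases p with
    | disjoint =>
      have h : ∀ x ∈ krSquare v w a b c, x ∉ W := fun x hx hxW =>
        Set.notMem_empty x (hp ▸ (⟨hx, hxW⟩ : x ∈ krSquare v w a b c ∩ W))
      rw [if_neg (h _ m1), if_neg (h _ m2), if_neg (h _ m3), if_neg (h _ m4)]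
    | knuthPair =>
      rcases hp with ⟨hp, -⟩ | ⟨hp, -⟩
      all_goals
        rw [if_congr (pair _ _ hp _ m1) rfl rfl, if_congr (pair _ _ hp _ m2) rfl rfl,
          if_congr (pair _ _ hp _ m3) rfl rfl, if_congr (pair _ _ hp _ m4) rfl rfl]
        simp [hinj, hab', hbc', hac', hab'.symm, hbc'.symm, hac'.symm]
    | rotationPair =>
      rcases hp with ⟨hp, -⟩ | ⟨hp, -⟩
      all_goals
        rw [if_congr (pair _ _ hp _ m1) rfl rfl, if_congr (pair _ _ hp _ m2) rfl rfl,
          if_congr (pair _ _ hp _ m3) rfl rfl, if_congr (pair _ _ hp _ m4) rfl rfl]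
        simp [hinj, hab', hbc', hac', hab'.symm, hbc'.symm, hac'.symm]
    | knuthFull => rw [if_pos (hp.1 m1), if_pos (hp.1 m2), if_pos (hp.1 m3), if_pos (hp.1 m4)]
    | rotationFull => rw [if_pos (hp.1 m1), if_pos (hp.1 m2), if_pos (hp.1 m3), if_pos (hp.1 m4)]
    | undetermined => rw [if_pos (hp.1 m1), if_pos (hp.1 m2), if_pos (hp.1 m3), if_pos (hp.1 m4)]
  · have h : ∀ x y z, [x, y, z].Perm [a, b, c] → insertTriple v w x y z ∉ H.verts := by
      intro x y z hperm hx
      refine hnd (((hperm.append_left v).append_right w).nodup_iff.1 (H.nodup _ hx))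
    have p1 : [b, a, c].Perm [a, b, c] := List.Perm.swap _ _ _
    have p2 : [a, c, b].Perm [a, b, c] := (List.Perm.swap _ _ _).cons _
    have p3 : [c, a, b].Perm [a, b, c] := (List.Perm.swap _ _ _).trans p2
    have p4 : [b, c, a].Perm [a, b, c] := ((List.Perm.swap _ _ _).cons _).trans p1
    rw [if_neg (h _ _ _ p1), if_neg (h _ _ _ p2), if_neg (h _ _ _ p3), if_neg (h _ _ _ p4)]

/-- The largest two-sided ideal on which the functional of a partial D₀ graph vanishes. -/
def kernelIdeal : TwoSidedIdeal (FreeAlg N) :=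
  TwoSidedIdeal.mk' {f | ∀ p q, H.functional (p * f * q) = 0}
    (by intro p q; simp)
    (by
      intro f g hf hg p q
      rw [mul_add, add_mul, map_add, hf, hg, add_zero])
    (by
      intro f hf p q
      rw [mul_neg, neg_mul, map_neg, hf, neg_zero])
    (by
      intro f g hg p q
      rw [← mul_assoc, hg])
    (by
      intro f g hf p q
      rw [← mul_assoc, mul_assoc _ g q, hf])

theorem addMonoidHom_eq_zero_of_wordMonomial (φ : FreeAlg N →+ ℤ)
    (h : ∀ w : KRWord N, φ (wordMonomial w) = 0) (f : FreeAlg N) : φ f = 0 := by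
  induction f using MonoidAlgebra.induction_linear with
  | zero => exact map_zero _
  | add f g hf hg => rw [map_add, hf, hg, add_zero]
  | single w r =>
    have h1 : MonoidAlgebra.single w r = r • wordMonomial (FreeMonoid.toList w) := by
      rw [wordMonomial, MonoidAlgebra.smul_single]
      simp
    rw [h1, map_zsmul, h, smul_zero]

/-- By additivity in each of the two outer factors, it suffices to test them on words. -/
theorem mem_kernelIdeal {f : FreeAlg N}
    (h : ∀ v w : KRWord N, H.functional (wordMonomial v * f * wordMonomial w) = 0) :
    f ∈ H.kernelIdeal := by
  rw [kernelIdeal, TwoSidedIdeal.mem_mk']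
  intro p q
  refine addMonoidHom_eq_zero_of_wordMonomial
    (H.functional.comp ((AddMonoidHom.mulRight q).comp (AddMonoidHom.mulRight f))) ?_ p
  intro v
  exact addMonoidHom_eq_zero_of_wordMonomial
    (H.functional.comp (AddMonoidHom.mulLeft (wordMonomial v * f))) (h v) q

theorem functional_eq_zero_of_mem_kernelIdeal {f : FreeAlg N} (h : f ∈ H.kernelIdeal) :
    H.functional f = 0 := by
  rw [kernelIdeal, TwoSidedIdeal.mem_mk'] at h
  simpa using h 1 1

theorem letter_mul_mul_letter_mem_kernelIdeal (a : Fin N) (f : FreeAlg N) :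
    letterMonomial a * f * letterMonomial a ∈ H.kernelIdeal := by
  refine H.mem_kernelIdeal fun v w => ?_
  refine addMonoidHom_eq_zero_of_wordMonomial
    (H.functional.comp ((AddMonoidHom.mulRight (wordMonomial w)).comp
      ((AddMonoidHom.mulLeft (wordMonomial v)).comp ((AddMonoidHom.mulRight (letterMonomial a)).comp
        (AddMonoidHom.mulLeft (letterMonomial a)))))) ?_ f
  intro x
  change H.functional (wordMonomial v * (wordMonomial [a] * wordMonomial x * wordMonomial [a]) *
    wordMonomial w) = 0
  simp only [wordMonomial_mul]
  rw [functional_wordMonomial, if_neg]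
  intro hmem
  have h := H.nodup _ hmem
  have h2 := (List.nodup_append.1 (List.nodup_append.1 h).1).2.1
  have h3 := (List.nodup_append.1 h2).2.2 a (by simp) a (by simp)
  exact h3 rfl

/-- The expansion is $bac+cab-bca-acb$, the combination balanced in every KR square. -/
theorem commutator_mem_kernelIdeal {a b c : Fin N} (hab : a < b) (hbc : b < c) :
    letterMonomial b * (letterMonomial a * letterMonomial c - letterMonomial c * letterMonomial a) -
      (letterMonomial a * letterMonomial c - letterMonomial c * letterMonomial a) * letterMonomial b
      ∈ H.kernelIdeal := by
  refine H.mem_kernelIdeal fun v w => ?_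
  have h := H.functional_krSquare v w hab hbc
  have h1 : ∀ x y z : Fin N, wordMonomial (insertTriple v w x y z) = wordMonomial v *
      (letterMonomial x * letterMonomial y * letterMonomial z) * wordMonomial w := by
    intro x y z
    simp [letterMonomial, wordMonomial_mul, insertTriple]
  simp only [h1] at h
  have h2 : wordMonomial v * (letterMonomial b * (letterMonomial a * letterMonomial c -
      letterMonomial c * letterMonomial a) - (letterMonomial a * letterMonomial c -
      letterMonomial c * letterMonomial a) * letterMonomial b) * wordMonomial w =
      wordMonomial v * (letterMonomial b * letterMonomial a * letterMonomial c) * wordMonomial w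
      + wordMonomial v * (letterMonomial c * letterMonomial a * letterMonomial b) * wordMonomial w
      - (wordMonomial v * (letterMonomial b * letterMonomial c * letterMonomial a) * wordMonomial w
      + wordMonomial v * (letterMonomial a * letterMonomial c * letterMonomial b) * wordMonomial w) := by
    noncomm_ring
  rw [h2, map_sub, map_add, map_add, h, sub_self]

end PartialD0Graph

/-! ### Schur expansion of the generating function -/

open Finset IsMulCommutative in
/-- Commuting elementary functions and their complete functions come from a commutative ring. -/
theorem exists_commRing_of_commute {A : Type} [Ring A] (E H : ℕ → A)
    (hcomm : ∀ j k, Commute (E j) (E k)) (hE : E 0 = 1) (hH : H 0 = 1)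
    (hrel : ∀ k, ∑ p ∈ antidiagonal (k + 1), (-1) ^ p.1 * (H p.1 * E p.2) = 0) :
    ∃ (C : Type) (_ : CommRing C) (ι : C →+* A) (e h : ℕ → C),
      (∀ k, ι (e k) = E k) ∧ (∀ k, ι (h k) = H k) ∧ e 0 = 1 ∧ h 0 = 1 ∧
      ∀ k, ∑ p ∈ antidiagonal (k + 1), (-1) ^ p.1 * (h p.1 * e p.2) = 0 := by
  set S := Subring.closure (Set.range E) with hS
  have hES : ∀ k, E k ∈ S := fun k => Subring.subset_closure ⟨k, rfl⟩
  -- As $E_0=1$, the relation expresses $H_{k+1}$ through earlier $H$'s and the $E$'s.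
  have hHS : ∀ k, H k ∈ S := by
    intro k
    induction k using Nat.strong_induction_on with
    | _ k ih =>
      cases k with
      | zero => rw [hH]; exact one_mem S
      | succ k =>
        have h1 := hrel k
        rw [Nat.sum_antidiagonal_succ', hE, mul_one, add_eq_zero_iff_eq_neg] at h1
        have h2 : (-1) ^ (k + 1) * H (k + 1) ∈ S := by
          rw [h1]
          refine neg_mem (sum_mem fun p hp => ?_)
          rw [HasAntidiagonal.mem_antidiagonal] at hp
          exact mul_mem (pow_mem (neg_mem (one_mem S)) _) (mul_mem (ih _ (by omega)) (hES _))
        have h3 : H (k + 1) = (-1) ^ (k + 1) * ((-1) ^ (k + 1) * H (k + 1)) := by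
          rw [← mul_assoc, ← pow_add, ← two_mul, pow_mul]
          simp
        rw [h3]
        exact mul_mem (pow_mem (neg_mem (one_mem S)) _) h2
  have : IsMulCommutative S := Subring.isMulCommutative_closure (by
    rintro _ ⟨j, rfl⟩ _ ⟨k, rfl⟩
    exact (hcomm j k).eq)
  refine ⟨S, inferInstance, ?_⟩
  refine ⟨S.subtype, fun k => ⟨E k, hES k⟩, fun k => ⟨H k, hHS k⟩, fun _ => rfl, fun _ => rfl,
    Subtype.ext hE, Subtype.ext hH, fun k => Subtype.ext ?_⟩
  exact (map_sum S.subtype _ _).trans (hrel k)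

theorem map_schurDet {N : ℕ} {A C : Type*} [Ring A] [CommRing C] (ι : C →+* A)
    (π : FreeAlg N →+* A) (e : ℕ → C)
    (he : ∀ k, ι (e k) = π (listElementary letterMonomial (letters N) k)) (μ : YoungDiagram) :
    ι (schurDet e μ) = π (ncSchur N μ) := by
  have h : ∀ d, ι (extendByZero e d) = π (ncElementary N d) := by
    intro d
    rw [ncElementary_eq, extendByZero, extendByZero]
    split_ifs
    · exact he _
    · rw [map_zero, map_zero]
  -- `Matrix.det_apply` permutes the row index, while $\mathfrak J_\mu$ permutes the column index;
  -- hence the transpose. The order of the factors is restored by writing the commutative product as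
  -- a list product.
  rw [schurDet, jacobiTrudi, ← Matrix.det_transpose, Matrix.det_apply, ncSchur, map_sum, map_sum]
  refine Finset.sum_congr rfl fun σ _ => ?_
  rw [Units.smul_def, map_zsmul, map_zsmul, ← List.prod_ofFn, map_list_prod, map_list_prod,
    List.map_ofFn, List.map_ofFn]
  congr 3
  funext j
  rw [Function.comp_apply, Function.comp_apply, ← h]
  rfl

namespace PartialD0Graph

variable {N n : ℕ} (H : PartialD0Graph N n)

theorem coeff_generatingFunction_eq_functional (m : ℕ →₀ ℕ) (r : ℕ) (hr : ∀ a ∈ m.support, a < r) :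
    MvPowerSeries.coeff m H.generatingFunction = H.functional
      (((List.range r).map fun i => listComplete letterMonomial (letters N) (m i)).prod) := by
  rw [generatingFunction, map_sum, functional_apply]
  exact Finset.sum_congr rfl fun w hw =>
    coeff_fundamentalQuasisymmetric w (H.length_eq w hw) (H.nodup w hw) m r hr

open Finset in
/-- The coefficients of the generating function factor through a commutative ring in which the
noncommutative Schur functions become Jacobi–Trudi determinants. -/
theorem exists_commRing_functional :
    ∃ (C : Type) (_ : CommRing C) (φ : C →+ ℤ) (e h : ℕ → C), e 0 = 1 ∧ h 0 = 1 ∧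
      (∀ k, ∑ p ∈ antidiagonal (k + 1), (-1) ^ p.1 * (h p.1 * e p.2) = 0) ∧
      (∀ m : ℕ →₀ ℕ, MvPowerSeries.coeff m H.generatingFunction = φ (m.prod fun _ k => h k)) ∧
      ∀ μ, wordPairing (ncSchur N μ) H.vertexSum = φ (schurDet e μ) := by
  set π := H.kernelIdeal.ringCon.mk' with hπ
  have hπs : Function.Surjective π := H.kernelIdeal.ringCon.mk'_surjective
  have hker : ∀ f, π f = 0 ↔ f ∈ H.kernelIdeal := fun f => by
    rw [TwoSidedIdeal.mem_iff, hπ, ← map_zero H.kernelIdeal.ringCon.mk']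
    exact RingCon.eq _
  set u : Fin N → H.kernelIdeal.ringCon.Quotient := fun a => π (letterMonomial a) with hu
  have hrep : ∀ a x, u a * x * u a = 0 := by
    intro a x
    obtain ⟨f, rfl⟩ := hπs x
    rw [hu, ← map_mul, ← map_mul, hker]
    exact H.letter_mul_mul_letter_mem_kernelIdeal a f
  have hcomm : ∀ a b c, a < b → b < c → Commute (u b) (u a * u c - u c * u a) := by
    intro a b c hab hbc
    rw [commute_iff_eq, ← sub_eq_zero]
    simp only [hu, ← map_mul, ← map_sub]
    rw [hker]
    exact H.commutator_mem_kernelIdeal hab hbc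
  obtain ⟨C, _, ι, e, h, he, hh, he0, hh0, hrel⟩ := exists_commRing_of_commute
    (listElementary u (letters N)) (listComplete u (letters N))
    (commute_listElementary u hrep hcomm _ (pairwise_letters N)) (by simp) (by simp)
    (sum_listComplete_mul_listElementary u hrep _)
  have hle : π.toAddMonoidHom.ker ≤ H.functional.ker := fun f hf =>
    H.functional_eq_zero_of_mem_kernelIdeal ((hker f).1 hf)
  -- The functional is only additive, but it vanishes on the ideal and so descends to the quotient.
  set ψ := π.toAddMonoidHom.liftOfRightInverse _ (Function.rightInverse_surjInv hπs)
    ⟨H.functional, hle⟩ with hψ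
  have hψπ : ∀ f, ψ (π f) = H.functional f := fun f =>
    AddMonoidHom.liftOfRightInverse_comp_apply _ _ _ _ f
  refine ⟨C, inferInstance, ψ.comp ι.toAddMonoidHom, e, h, he0, hh0, hrel, fun m => ?_, fun μ => ?_⟩
  · obtain ⟨r, hr⟩ : ∃ r, ∀ a ∈ m.support, a < r :=
      ⟨m.support.sup id + 1, fun a ha => Nat.lt_succ_of_le (le_sup (f := id) ha)⟩
    rw [H.coeff_generatingFunction_eq_functional m r hr, ← hψπ]
    change _ = ψ (ι _)
    congr 1
    -- Indices below $r$ outside the support of $m$ contribute $h_0=1$.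
    rw [map_list_prod, List.map_map,
      Finsupp.prod_of_support_subset m (s := range r) (fun a ha => mem_range.2 (hr a ha)) _
        (fun _ _ => hh0), ← List.toFinset_range, List.prod_toFinset _ List.nodup_range,
      map_list_prod, List.map_map]
    congr 1
    refine List.map_congr_left fun i _ => ?_
    rw [Function.comp_apply, Function.comp_apply, hh, map_listComplete]
  · rw [wordPairing_vertexSum, ← hψπ]
    change _ = ψ (ι _)
    rw [map_schurDet ι π e fun k => by rw [he, map_listElementary]]

theorem wordPairing_ncSchur_eq_zero {μ : YoungDiagram} (h : μ.card ≠ n) :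
    wordPairing (ncSchur N μ) H.vertexSum = 0 := by
  rw [wordPairing_vertexSum]
  exact H.functional_eq_zero (ncSchur_mem_homogeneousPart μ) (by exact_mod_cast h)

/-- The coefficients of the Schur expansion of the generating function. -/
def schurCoefficients : YoungDiagram →₀ ℤ :=
  Finsupp.onFinset (YoungDiagram.ofCard n) (fun μ => wordPairing (ncSchur N μ) H.vertexSum)
    fun _ h => YoungDiagram.mem_ofCard.2 (by_contra fun h' => h (H.wordPairing_ncSchur_eq_zero h'))

theorem schurCoefficients_apply (μ : YoungDiagram) :
    H.schurCoefficients μ = wordPairing (ncSchur N μ) H.vertexSum := rfl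

theorem coeff_generatingFunction (m : ℕ →₀ ℕ) :
    MvPowerSeries.coeff m H.generatingFunction = ∑ μ ∈ YoungDiagram.ofCard m.degree,
      H.schurCoefficients μ * SemistandardYoungTableau.kostka μ m := by
  obtain ⟨C, _, φ, e, h, he, hh, hrel, h1, h2⟩ := H.exists_commRing_functional
  rw [h1, SemistandardYoungTableau.prod_complete_eq_sum_kostka e h he hh hrel, map_sum]
  refine Finset.sum_congr rfl fun μ _ => ?_
  rw [schurCoefficients_apply, h2, ← nsmul_eq_mul, map_nsmul, nsmul_eq_mul, mul_comm]

theorem generatingFunction_eq :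
    H.generatingFunction = H.schurCoefficients.sum fun μ a => a • schurFunction μ := by
  ext m
  have hs : H.schurCoefficients.support ⊆ YoungDiagram.ofCard n := Finsupp.support_onFinset_subset
  rw [coeff_sum_smul_schurFunction, coeff_generatingFunction,
    Finsupp.sum_of_support_subset _ hs _ (by simp)]
  -- Off degree $n$ both sums vanish: diagrams of size $\deg m$ have coefficient zero, and diagrams
  -- of size $n$ carry no tableau of content $m$.
  by_cases hm : m.degree = n
  · rw [hm]
  · rw [Finset.sum_eq_zero, Finset.sum_eq_zero]
    · intro μ hμ
      rw [YoungDiagram.mem_ofCard] at hμ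
      rw [SemistandardYoungTableau.kostka_eq_zero (by omega), Nat.cast_zero, mul_zero]
    · intro μ hμ
      rw [YoungDiagram.mem_ofCard] at hμ
      rw [schurCoefficients_apply, H.wordPairing_ncSchur_eq_zero (by omega), zero_mul]

theorem isSymmetricFunction_generatingFunction : IsSymmetricFunction H.generatingFunction := by
  refine ⟨⟨n, fun m hm => ?_⟩, fun σ => ?_⟩
  · by_contra hlt
    refine hm ?_
    rw [coeff_generatingFunction]
    refine Finset.sum_eq_zero fun μ hμ => ?_
    rw [YoungDiagram.mem_ofCard] at hμ
    rw [schurCoefficients_apply, H.wordPairing_ncSchur_eq_zero (by omega), zero_mul]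
  -- The coefficient of $x^m$ is $\varphi(\prod_i h_{m_i})$ with commuting factors, so permuting the
  -- exponents does not change it.
  · obtain ⟨C, _, φ, e, h, -, -, -, h1, -⟩ := H.exists_commRing_functional
    ext m
    obtain ⟨m, rfl⟩ : ∃ m', m = Finsupp.embDomain σ.toEmbedding m' :=
      ⟨Finsupp.embDomain σ.symm.toEmbedding m, by
        ext a
        obtain ⟨b, rfl⟩ := σ.surjective a
        have h2 := Finsupp.embDomain_apply_self σ.symm.toEmbedding m (σ b)
        rw [Equiv.coe_toEmbedding, Equiv.symm_apply_apply] at h2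
        exact ((Finsupp.embDomain_apply_self σ.toEmbedding _ b).trans h2).symm⟩
    refine (MvPowerSeries.coeff_embDomain_rename σ.toEmbedding _ m).trans ?_
    rw [h1, h1, Finsupp.prod_embDomain]

end PartialD0Graph

end

/-- The generating function of a partial D₀ graph `H` (in particular of a D₀ graph) is symmetric;
it is a linear combination of Schur functions in exactly one way, and the coefficient of `s_μ`
is `⟨𝔍_μ(u), ∑_{w ∈ V(H)} w⟩`. -/
theorem corollaryc (N n : ℕ) (H : PartialD0Graph N n) :
    IsSymmetricFunction H.generatingFunction ∧
      ∃ c : YoungDiagram →₀ ℤ,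
        H.generatingFunction = (c.sum fun μ a => a • schurFunction μ) ∧
        (∀ c' : YoungDiagram →₀ ℤ,
          H.generatingFunction = (c'.sum fun μ a => a • schurFunction μ) → c' = c) ∧
        ∀ μ : YoungDiagram, c μ = wordPairing (ncSchur N μ) H.vertexSum := by
  refine ⟨H.isSymmetricFunction_generatingFunction, H.schurCoefficients, H.generatingFunction_eq,
    fun c' hc' => ?_, H.schurCoefficients_apply⟩
  exact linearIndependent_schurFunction (hc'.symm.trans H.generatingFunction_eq)
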